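/- Let $p$ be a prime, $n\ge 0$ an integer, $\mathbb Z_p=\mathbb Z/p\mathbb Z$, $G=\mathbb Z_p^n$, $H=\mathbb Z_p$ and $\tilde G=G\times H=\mathbb Z_p^{n+1}$. For integers $k,m\ge 0$ let $G(k,m)$ denote the number of $k$-dimensional subspaces of the $\mathbb Z_p$-vector space $\mathbb Z_p^m$. Let $A(\tilde G)$ be the Burnside ring of $\tilde G$ (the Grothendieck construction on isomorphism classes of finite $\tilde G$-sets, with addition given by disjoint union), let $R(\tilde G)$ be the rational representation ring (the Grothendieck construction on isomorphism classes of finitely generated $\mathbb Q[\tilde G]$-modules, with addition given by direct sum), and let $N$ be the kernel of the natural map $f:A(\tilde G)\to R(\tilde G)$, $[X]\mapsto[\mathbb Q[X]]$, which sends a finite $\tilde G$-set to its permutation module. Let $A(G,H)$ be the Grothendieck group of the monoid of isomorphism classes of finite $\tilde G$-sets on which $H$ acts freely (under disjoint union), let $R(G,H)$ be the Grothendieck group of the monoid of isomorphism classes of finitely generated $\mathbb Q[\tilde G]$-modules that are free as $\mathbb Q[H]$-modules (under direct sum), and let $N'$ be the kernel of the map $f':A(G,H)\to R(G,H)$, $[X]\mapsto[\mathbb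 Q[X]]$. Then $N$ and $N'$ are free abelian groups of finite ranks $b$ and $b'$ respectively, where $$b=\sum_{k=0}^{n-1}G(k,n+1),\qquad b'=\sum_{k=0}^{n}p^k\,G(k,n)-G(1,n+1).$$ -/

import Mathlib

open Algebra

noncomputable section

/-! ### The Burnside group -/

/-- A finite left `G`-set. -/
structure FinGSet (G : Type) [Group G] : Type 1 where
  (carrier : Type)
  [action : MulAction G carrier]
  [finite : Finite carrier]

attribute [instance] FinGSet.action FinGSet.finite

/-- Isomorphism of finite `G`-sets: a `G`-equivariant bijection. -/
instance FinGSet.setoid (G : Type) [Group G] : Setoid (FinGSet G) where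
  r X Y := ∃ e : X.carrier ≃ Y.carrier, ∀ (g : G) (x : X.carrier), e (g • x) = g • e x
  iseqv :=
    { refl := fun _ => ⟨Equiv.refl _, fun _ _ => rfl⟩
      symm := by
        rintro X Y ⟨e, he⟩
        refine ⟨e.symm, fun g y => ?_⟩
        rw [Equiv.symm_apply_eq, he, Equiv.apply_symm_apply]
      trans := by
        rintro X Y Z ⟨e, he⟩ ⟨e', he'⟩
        exact ⟨e.trans e', fun g x => by simp [he, he']⟩ }

/-- The isomorphism classes of finite `G`-sets. -/
def FinGSetClass (G : Type) [Group G] : Type 1 := Quotient (FinGSet.setoid G)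

/-- The isomorphism class of a finite `G`-set. -/
def FinGSet.cls {G : Type} [Group G] (X : FinGSet G) : FinGSetClass G :=
  Quotient.mk (FinGSet.setoid G) X

/-- Disjoint union of finite `G`-sets. -/
def FinGSet.sum {G : Type} [Group G] (X Y : FinGSet G) : FinGSet G where
  carrier := X.carrier ⊕ Y.carrier

/-- The empty `G`-set. -/
def FinGSet.empty (G : Type) [Group G] : FinGSet G where
  carrier := PEmpty
  action := { smul := fun _ x => x, one_smul := fun _ => rfl, mul_smul := fun _ _ _ => rfl }

instance FinGSetClass.instZero (G : Type) [Group G] : Zero (FinGSetClass G) := ⟨(FinGSet.empty G).cls⟩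

instance FinGSetClass.instAdd (G : Type) [Group G] : Add (FinGSetClass G) where
  add := Quotient.map₂ FinGSet.sum (by
    rintro X X' ⟨e, he⟩ Y Y' ⟨e', he'⟩
    refine ⟨Equiv.sumCongr e e', ?_⟩
    rintro g (x | y)
    · exact congrArg Sum.inl (he g x)
    · exact congrArg Sum.inr (he' g y))

/-- Isomorphism classes of finite `G`-sets form a commutative monoid under disjoint union. -/
instance FinGSetClass.addCommMonoid (G : Type) [Group G] : AddCommMonoid (FinGSetClass G) where
  add_assoc := by
    rintro ⟨X⟩ ⟨Y⟩ ⟨Z⟩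
    refine Quotient.sound ⟨Equiv.sumAssoc _ _ _, ?_⟩
    rintro g ((x | y) | z) <;> rfl
  zero_add := by
    rintro ⟨X⟩
    refine Quotient.sound ⟨Equiv.emptySum PEmpty X.carrier, ?_⟩
    rintro g (x | y)
    · exact x.elim
    · rfl
  add_zero := by
    rintro ⟨X⟩
    refine Quotient.sound ⟨Equiv.sumEmpty X.carrier PEmpty, ?_⟩
    rintro g (x | y)
    · rfl
    · exact y.elim
  add_comm := by
    rintro ⟨X⟩ ⟨Y⟩
    refine Quotient.sound ⟨Equiv.sumComm _ _, ?_⟩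
    rintro g (x | y) <;> rfl
  nsmul := nsmulRec

/-- The additive group of the Burnside ring `A(G)`: the Grothendieck group of the monoid of
isomorphism classes of finite `G`-sets under disjoint union. (The product is not needed for ranks.) -/
abbrev BurnsideGroup (G : Type) [Group G] : Type 1 := GrothendieckAddGroup (FinGSetClass G)

/-! ### The rational representation group -/

/-- A finitely generated left `ℚ[G]`-module. -/
structure RatMod (G : Type) [Group G] : Type 1 where
  (carrier : Type)
  [addCommGroup : AddCommGroup carrier]
  [module : Module (MonoidAlgebra ℚ G) carrier]
  [finite : Module.Finite (MonoidAlgebra ℚ G) carrier]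

attribute [instance] RatMod.addCommGroup RatMod.module RatMod.finite

/-- Isomorphism of `ℚ[G]`-modules. -/
instance RatMod.setoid (G : Type) [Group G] : Setoid (RatMod G) where
  r V W := Nonempty (V.carrier ≃ₗ[MonoidAlgebra ℚ G] W.carrier)
  iseqv :=
    { refl := fun _ => ⟨LinearEquiv.refl _ _⟩
      symm := fun ⟨e⟩ => ⟨e.symm⟩
      trans := fun ⟨e⟩ ⟨e'⟩ => ⟨e.trans e'⟩ }

/-- The isomorphism classes of finitely generated `ℚ[G]`-modules. -/
def RatModClass (G : Type) [Group G] : Type 1 := Quotient (RatMod.setoid G)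

/-- The isomorphism class of a finitely generated `ℚ[G]`-module. -/
def RatMod.cls {G : Type} [Group G] (V : RatMod G) : RatModClass G :=
  Quotient.mk (RatMod.setoid G) V

/-- Direct sum of finitely generated `ℚ[G]`-modules. -/
def RatMod.sum {G : Type} [Group G] (V W : RatMod G) : RatMod G where
  carrier := V.carrier × W.carrier

/-- The zero `ℚ[G]`-module. -/
def RatMod.zero (G : Type) [Group G] : RatMod G where
  carrier := PUnit

instance RatModClass.instZero (G : Type) [Group G] : Zero (RatModClass G) := ⟨(RatMod.zero G).cls⟩

instance RatModClass.instAdd (G : Type) [Group G] : Add (RatModClass G) where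
  add := Quotient.map₂ RatMod.sum (by
    rintro V V' ⟨e⟩ W W' ⟨e'⟩
    exact ⟨LinearEquiv.prodCongr e e'⟩)

/-- Isomorphism classes of finitely generated `ℚ[G]`-modules form a commutative monoid under
direct sum. -/
instance RatModClass.addCommMonoid (G : Type) [Group G] : AddCommMonoid (RatModClass G) where
  add_assoc := by
    rintro ⟨U⟩ ⟨V⟩ ⟨W⟩
    exact Quotient.sound ⟨LinearEquiv.prodAssoc _ _ _ _⟩
  zero_add := by
    rintro ⟨V⟩
    exact Quotient.sound ⟨(LinearEquiv.uniqueProd :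
      (PUnit.{1} × V.carrier) ≃ₗ[MonoidAlgebra ℚ G] V.carrier)⟩
  add_zero := by
    rintro ⟨V⟩
    exact Quotient.sound ⟨(LinearEquiv.prodUnique :
      (V.carrier × PUnit.{1}) ≃ₗ[MonoidAlgebra ℚ G] V.carrier)⟩
  add_comm := by
    rintro ⟨V⟩ ⟨W⟩
    exact Quotient.sound ⟨LinearEquiv.prodComm _ _ _⟩
  nsmul := nsmulRec

/-- The additive group of the rational representation ring `R(G)`: the Grothendieck group of the
monoid of isomorphism classes of finitely generated `ℚ[G]`-modules under direct sum. -/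
abbrev RepGroup (G : Type) [Group G] : Type 1 := GrothendieckAddGroup (RatModClass G)

/-! ### The permutation module map and the Burnside kernel -/

/-- The permutation `ℚ[G]`-module `ℚ[X]` of a finite `G`-set `X`. -/
def permMod {G : Type} [Group G] (X : FinGSet G) : RatMod G where
  carrier := (Representation.ofMulAction ℚ G X.carrier).asModule
  finite := by
    have : Module.Finite ℚ (MonoidAlgebra ℚ X.carrier) :=
      Module.Finite.equiv (MonoidAlgebra.coeffLinearEquiv ℚ).symm
    exact Module.Finite.of_restrictScalars_finite ℚ (MonoidAlgebra ℚ G) _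

/-- The action on the permutation module: `(c g) (r x) = (c r) (g x)`. -/
theorem single_smul_single {G X : Type} [Group G] [MulAction G X] (g : G) (c r : ℚ) (x : X) :
    MonoidAlgebra.single g c • (Representation.ofMulAction ℚ G X).asModuleEquiv.symm
      (MonoidAlgebra.single x r) =
    (Representation.ofMulAction ℚ G X).asModuleEquiv.symm
      (MonoidAlgebra.single (g • x) (c * r)) := by
  rw [Representation.single_smul, LinearEquiv.apply_symm_apply,
    Representation.ofMulAction_single]
  change c • MonoidAlgebra.single (g • x) r = MonoidAlgebra.single (g • x) (c * r)
  simp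

/-- An additive map out of `ℚ[X]` compatible with the action on basis elements is
`ℚ[G]`-linear. -/
theorem map_smul_of_single {G X W : Type} [Group G] [MulAction G X] [AddCommGroup W]
    [Module (MonoidAlgebra ℚ G) W] (e : (Representation.ofMulAction ℚ G X).asModule →+ W)
    (he : ∀ (g : G) (c r : ℚ) (x : X),
      e ((Representation.ofMulAction ℚ G X).asModuleEquiv.symm
        (MonoidAlgebra.single (g • x) (c * r))) =
      MonoidAlgebra.single g c • e ((Representation.ofMulAction ℚ G X).asModuleEquiv.symm
        (MonoidAlgebra.single x r)))
    (a : MonoidAlgebra ℚ G) (v : (Representation.ofMulAction ℚ G X).asModule) :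
    e (a • v) = a • e v := by
  obtain ⟨v, rfl⟩ := (Representation.ofMulAction ℚ G X).asModuleEquiv.symm.surjective v
  induction a using MonoidAlgebra.induction_linear with
  | zero => rw [zero_smul, zero_smul, map_zero]
  | add a b ha hb => rw [add_smul, map_add, ha, hb, add_smul]
  | single g c =>
    induction v using MonoidAlgebra.induction_linear with
    | zero => rw [map_zero, smul_zero, map_zero, smul_zero]
    | add v w hv hw => rw [map_add, smul_add, map_add, map_add, smul_add, hv, hw]
    | single x r => rw [single_smul_single, he]

/-- `X ↦ ℚ[X]` on isomorphism classes, as a map of monoids. -/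
def permClass (G : Type) [Group G] : FinGSetClass G →+ RatModClass G where
  toFun := Quotient.map permMod (by
    rintro X Y ⟨e, he⟩
    let E : (Representation.ofMulAction ℚ G X.carrier).asModule ≃ₗ[ℚ]
        (Representation.ofMulAction ℚ G Y.carrier).asModule :=
      (Representation.ofMulAction ℚ G X.carrier).asModuleEquiv.trans
        (((MonoidAlgebra.coeffLinearEquiv ℚ).trans ((Finsupp.domLCongr e).trans
        (MonoidAlgebra.coeffLinearEquiv ℚ).symm)).trans
          (Representation.ofMulAction ℚ G Y.carrier).asModuleEquiv.symm)
    have hE : ∀ x r, E ((Representation.ofMulAction ℚ G X.carrier).asModuleEquiv.symm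
        (MonoidAlgebra.single x r)) =
        (Representation.ofMulAction ℚ G Y.carrier).asModuleEquiv.symm
          (MonoidAlgebra.single (e x) r) := by
      intro x r
      simp [E]
    refine ⟨E.toAddEquiv.toLinearEquiv (map_smul_of_single E.toAddEquiv.toAddMonoidHom ?_)⟩
    intro g c r x
    change E _ = _ • E _
    rw [hE, hE, single_smul_single, he])
  map_zero' := by
    have : Subsingleton (permMod (FinGSet.empty G)).carrier :=
      (MonoidAlgebra.coeffEquiv (R := ℚ) (M := PEmpty.{1})).injective.subsingleton
    have : Subsingleton (RatMod.zero G).carrier := inferInstanceAs (Subsingleton PUnit)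
    exact Quotient.sound ⟨LinearEquiv.ofSubsingleton _ _⟩
  map_add' := by
    rintro ⟨X⟩ ⟨Y⟩
    let E : (Representation.ofMulAction ℚ G (X.carrier ⊕ Y.carrier)).asModule ≃ₗ[ℚ]
        (Representation.ofMulAction ℚ G X.carrier).asModule ×
        (Representation.ofMulAction ℚ G Y.carrier).asModule :=
      (Representation.ofMulAction ℚ G (X.carrier ⊕ Y.carrier)).asModuleEquiv.trans
      ((MonoidAlgebra.coeffLinearEquiv ℚ).trans ((Finsupp.sumFinsuppLEquivProdFinsupp ℚ).trans
        (LinearEquiv.prodCongr ((MonoidAlgebra.coeffLinearEquiv ℚ).symm.trans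
          (Representation.ofMulAction ℚ G X.carrier).asModuleEquiv.symm)
          ((MonoidAlgebra.coeffLinearEquiv ℚ).symm.trans
          (Representation.ofMulAction ℚ G Y.carrier).asModuleEquiv.symm))))
    have hE₁ : ∀ x r, E ((Representation.ofMulAction ℚ G
        (X.carrier ⊕ Y.carrier)).asModuleEquiv.symm (MonoidAlgebra.single (Sum.inl x) r)) =
        ((Representation.ofMulAction ℚ G X.carrier).asModuleEquiv.symm
          (MonoidAlgebra.single x r), 0) := by
      intro x r
      simp [E, Finsupp.sumFinsuppLEquivProdFinsupp]
    have hE₂ : ∀ y r, E ((Representation.ofMulAction ℚ G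
        (X.carrier ⊕ Y.carrier)).asModuleEquiv.symm (MonoidAlgebra.single (Sum.inr y) r)) =
        (0, (Representation.ofMulAction ℚ G Y.carrier).asModuleEquiv.symm
          (MonoidAlgebra.single y r)) := by
      intro y r
      simp [E, Finsupp.sumFinsuppLEquivProdFinsupp]
    refine Quotient.sound
      ⟨E.toAddEquiv.toLinearEquiv (map_smul_of_single E.toAddEquiv.toAddMonoidHom ?_)⟩
    rintro g c r (x | y)
    · change E _ = _ • E _
      rw [Sum.smul_inl, hE₁, hE₁, Prod.smul_mk, single_smul_single, smul_zero]
    · change E _ = _ • E _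
      rw [Sum.smul_inr, hE₂, hE₂, Prod.smul_mk, single_smul_single, smul_zero]

/-- The map of Grothendieck groups induced by a map of commutative monoids. -/
def grothendieckMap {M N : Type*} [AddCommMonoid M] [AddCommMonoid N] (φ : M →+ N) :
    GrothendieckAddGroup M →+ GrothendieckAddGroup N :=
  GrothendieckAddGroup.lift (GrothendieckAddGroup.of.comp φ)

/-- The natural map `f : A(G) → R(G)`, `[X] ↦ [ℚ[X]]`. -/
def burnsideMap (G : Type) [Group G] : BurnsideGroup G →+ RepGroup G :=
  grothendieckMap (permClass G)

/-- The Burnside kernel `N(G)`. -/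
abbrev burnsideKernel (G : Type) [Group G] : AddSubgroup (BurnsideGroup G) :=
  (burnsideMap G).ker

/-! ### The relative versions, for `G × H` -/

/-- A `(G × H)`-set is `H`-free if no nontrivial element of `H` fixes a point. -/
def FinGSet.IsFreeOver {G : Type} (H : Type) [Group G] [Group H] (X : FinGSet (G × H)) : Prop :=
  ∀ (h : H) (x : X.carrier), ((1, h) : G × H) • x = x → h = 1

/-- A `ℚ[G × H]`-module is `ℚ[H]`-free if it becomes a free module when the scalars are
restricted along `ℚ[H] → ℚ[G × H]`, `h ↦ (1, h)`. -/
def RatMod.IsFreeOver {G : Type} (H : Type) [Group G] [Group H] (V : RatMod (G × H)) : Prop :=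
  letI : Module (MonoidAlgebra ℚ H) V.carrier :=
    Module.compHom V.carrier (MonoidAlgebra.mapDomainRingHom ℚ (MonoidHom.inr G H))
  Module.Free (MonoidAlgebra ℚ H) V.carrier

/-- The monoid of isomorphism classes of finite `H`-free `(G × H)`-sets. -/
def relFinGSetClass (G H : Type) [Group G] [Group H] : AddSubmonoid (FinGSetClass (G × H)) where
  carrier := {s | ∃ X : FinGSet (G × H), X.IsFreeOver H ∧ X.cls = s}
  zero_mem' := ⟨FinGSet.empty _, fun _ x => PEmpty.elim x, rfl⟩
  add_mem' := by
    rintro _ _ ⟨X, hX, rfl⟩ ⟨Y, hY, rfl⟩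
    refine ⟨X.sum Y, ?_, rfl⟩
    rintro h (x | y) hx
    · exact hX h x (Sum.inl_injective hx)
    · exact hY h y (Sum.inr_injective hx)

/-- The monoid of isomorphism classes of finitely generated `ℚ[H]`-free `ℚ[G × H]`-modules. -/
def relRatModClass (G H : Type) [Group G] [Group H] : AddSubmonoid (RatModClass (G × H)) where
  carrier := {t | ∃ V : RatMod (G × H), V.IsFreeOver H ∧ V.cls = t}
  zero_mem' := by
    refine ⟨RatMod.zero _, ?_, rfl⟩
    let _ : Module (MonoidAlgebra ℚ H) PUnit.{1} :=
      Module.compHom PUnit.{1} (MonoidAlgebra.mapDomainRingHom ℚ (MonoidHom.inr G H))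
    exact (inferInstance : Module.Free (MonoidAlgebra ℚ H) PUnit.{1})
  add_mem' := by
    rintro _ _ ⟨V, hV, rfl⟩ ⟨W, hW, rfl⟩
    refine ⟨V.sum W, ?_, rfl⟩
    let _ : Module (MonoidAlgebra ℚ H) V.carrier :=
      Module.compHom V.carrier (MonoidAlgebra.mapDomainRingHom ℚ (MonoidHom.inr G H))
    let _ : Module (MonoidAlgebra ℚ H) W.carrier :=
      Module.compHom W.carrier (MonoidAlgebra.mapDomainRingHom ℚ (MonoidHom.inr G H))
    have : Module.Free (MonoidAlgebra ℚ H) V.carrier := hV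
    have : Module.Free (MonoidAlgebra ℚ H) W.carrier := hW
    exact (inferInstance : Module.Free (MonoidAlgebra ℚ H) (V.carrier × W.carrier))

/-- The relative Burnside module `A(G, H)`. -/
abbrev RelBurnside (G H : Type) [Group G] [Group H] : Type 1 :=
  GrothendieckAddGroup (relFinGSetClass G H)

/-- The relative rational representation module `R(G, H)`. -/
abbrev RelRep (G H : Type) [Group G] [Group H] : Type 1 :=
  GrothendieckAddGroup (relRatModClass G H)

/-- If `X` is `H`-free then `ℚ[X]` is `ℚ[H]`-free. -/
theorem permMod_isFreeOver {G H : Type} [Group G] [Group H] (X : FinGSet (G × H))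
    (hX : X.IsFreeOver H) : (permMod X).IsFreeOver H := by
  let ρ := Representation.ofMulAction ℚ (G × H) X.carrier
  let _ : MulAction H X.carrier := MulAction.compHom X.carrier (MonoidHom.inr G H)
  let _ : Module (MonoidAlgebra ℚ H) ρ.asModule :=
    Module.compHom ρ.asModule (MonoidAlgebra.mapDomainRingHom ℚ (MonoidHom.inr G H))
  change Module.Free (MonoidAlgebra ℚ H) ρ.asModule
  have hsmul : ∀ (h : H) (c r : ℚ) (x : X.carrier),
      MonoidAlgebra.single h c • ρ.asModuleEquiv.symm (MonoidAlgebra.single x r) =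
        ρ.asModuleEquiv.symm (MonoidAlgebra.single (h • x) (c * r)) := by
    intro h c r x
    change MonoidAlgebra.mapDomainRingHom ℚ (MonoidHom.inr G H) (MonoidAlgebra.single h c) •
      ρ.asModuleEquiv.symm (MonoidAlgebra.single x r) = _
    rw [MonoidAlgebra.mapDomainRingHom_apply, MonoidAlgebra.mapDomain_single]
    exact single_smul_single _ _ _ _
  let Ω := MulAction.orbitRel.Quotient H X.carrier
  let b : Ω × H → X.carrier := fun q => q.2 • q.1.out
  have hb : Function.Bijective b := by
    constructor
    · rintro ⟨o, h⟩ ⟨o', h'⟩ hq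
      change h • o.out = h' • o'.out at hq
      have ho : o = o' := by
        rw [← Quotient.out_eq o, ← Quotient.out_eq o']
        refine Quotient.sound (MulAction.orbitRel_apply.2 ⟨h⁻¹ * h', ?_⟩)
        change (h⁻¹ * h') • o'.out = o.out
        rw [mul_smul, ← hq, inv_smul_smul]
      subst ho
      have hf : (h⁻¹ * h') • o.out = o.out := by rw [mul_smul, ← hq, inv_smul_smul]
      have h1 : h⁻¹ * h' = 1 := hX _ _ hf
      rw [inv_mul_eq_one] at h1
      rw [h1]
    · intro x
      have hx : x ∈ MulAction.orbit H (Quotient.mk (MulAction.orbitRel H X.carrier) x).out :=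
        MulAction.orbitRel_apply.1 ((MulAction.orbitRel H X.carrier).symm
          (Quotient.mk_out (s := MulAction.orbitRel H X.carrier) x))
      obtain ⟨h, hh⟩ := hx
      exact ⟨(Quotient.mk (MulAction.orbitRel H X.carrier) x, h), hh⟩
  let B : (Ω →₀ MonoidAlgebra ℚ H) ≃+ ρ.asModule :=
    ((Finsupp.mapRange.linearEquiv (MonoidAlgebra.coeffLinearEquiv ℚ)).trans
      ((Finsupp.curryLinearEquiv ℚ).symm.trans ((Finsupp.domLCongr (Equiv.ofBijective b hb)).trans
        ((MonoidAlgebra.coeffLinearEquiv ℚ).symm.trans ρ.asModuleEquiv.symm)))).toAddEquiv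
  let L : (Ω →₀ MonoidAlgebra ℚ H) →ₗ[MonoidAlgebra ℚ H] ρ.asModule :=
    Finsupp.linearCombination (MonoidAlgebra ℚ H)
      (fun o : Ω => ρ.asModuleEquiv.symm (MonoidAlgebra.single o.out 1))
  have hLB : L.toAddMonoidHom = B.toAddMonoidHom := by
    refine Finsupp.addHom_ext fun o a => ?_
    change L (Finsupp.single o a) = B (Finsupp.single o a)
    induction a using MonoidAlgebra.induction_linear with
    | zero => rw [Finsupp.single_zero, map_zero, map_zero]
    | add a a' ha ha' => rw [Finsupp.single_add, map_add, map_add, ha, ha']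
    | single h c =>
      have h1 : L (Finsupp.single o (MonoidAlgebra.single h c)) =
          ρ.asModuleEquiv.symm (MonoidAlgebra.single (h • o.out) c) := by
        rw [Finsupp.linearCombination_single, hsmul, mul_one]
      rw [h1]
      simp [B, b, Finsupp.curryLinearEquiv]
  have hL : Function.Bijective L := by
    have : (L : (Ω →₀ MonoidAlgebra ℚ H) → ρ.asModule) = B :=
      funext fun v => DFunLike.congr_fun hLB v
    rw [this]
    exact B.bijective
  exact Module.Free.of_equiv (LinearEquiv.ofBijective L hL)

/-- `X ↦ ℚ[X]` on isomorphism classes of `H`-free `(G × H)`-sets. -/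
def relPermClass (G H : Type) [Group G] [Group H] :
    relFinGSetClass G H →+ relRatModClass G H :=
  ((permClass (G × H)).comp (relFinGSetClass G H).subtype).codRestrict (relRatModClass G H) (by
    rintro ⟨_, X, hX, rfl⟩
    exact ⟨permMod X, permMod_isFreeOver X hX, rfl⟩)

/-- The natural map `f' : A(G, H) → R(G, H)`, `[X] ↦ [ℚ[X]]`. -/
def relBurnsideMap (G H : Type) [Group G] [Group H] : RelBurnside G H →+ RelRep G H :=
  grothendieckMap (relPermClass G H)

/-- The relative Burnside kernel `N(G, H)`. -/
abbrev relBurnsideKernel (G H : Type) [Group G] [Group H] : AddSubgroup (RelBurnside G H) :=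
  (relBurnsideMap G H).ker

/-! ### Elementary abelian groups and subspace counts -/

/-- The elementary abelian group `ℤ_p ^ n`, written multiplicatively. -/
abbrev ElemAb (p n : ℕ) : Type := Multiplicative (Fin n → ZMod p)

/-- The number of `k`-dimensional subspaces of the vector space `ℤ_p ^ m`. -/
def numSubspaces (p k m : ℕ) [Fact p.Prime] : ℕ :=
  Nat.card {W : Submodule (ZMod p) (Fin m → ZMod p) // Module.finrank (ZMod p) W = k}

end

/-! The kernels are computed without classifying rational representations. The form dim_ℚ Hom(V, W)
on the representation group is definite: by Maschke's theorem a nonzero map splits off a common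
summand, so a class of self-pairing zero vanishes (`nonempty_linearEquiv_of_homDim`,
`homForm_self_eq_zero_iff`). A combination of permutation modules is therefore zero exactly when its
self-pairing is.

For abelian groups, the pairing of ℚ[G/K] with ℚ[G/L] counts the orbits on G/K × G/L, which is the
index of K + L (`homDim_coset`). In a vector space V over ℤ_p this index is the number of
functionals killing both K and L, i.e. the inner product of the indicators of the annihilators of K
and L in V*. So Σ c_K [G/K] lies in the kernel iff Σ c_K 1_{K^⊥} = 0 as a function on V*
(`burnsideMap_eq_zero_iff`). Coset spaces being a basis of the Burnside group, the rank of the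
kernel is the number of admissible K minus the rank of the span of these indicators (`kernel_rank`).

A nonzero functional has exactly one hyperplane as kernel, so 1_{K^⊥} is 1_{0} plus the sum of
1_{L^⊥} - 1_{0} over hyperplanes L ⊇ K (`annInd_eq_top_add_sum`). With all K allowed, the subspaces
of codimension at most one index a basis of the span, and the remaining subspaces, those of
dimension < n, are counted by b.

In the relative case the form shows that R(G,H) embeds in R(G × H), so the same vectors serve, now
with K meeting the line H trivially. These K are graphs of functionals on subspaces of ℤ_p^n, whence
Σ p^k G(k,n). The identity p |V/(K+H)| = |V/K| is one linear relation on their indicators, violated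
by 1_{0} (`freeTrace`). The span thus loses one dimension, and has a basis indexed by hyperplanes
(`sliceSubspace`), which are as numerous as lines. -/

noncomputable section

/-! ### The Hom form on the representation group -/

/-- The `ℚ`-vector space structure underlying a `ℚ[G]`-module. -/
instance RatMod.ratModule {G : Type} [Group G] (V : RatMod G) : Module ℚ V.carrier :=
  Module.compHom V.carrier (algebraMap ℚ (MonoidAlgebra ℚ G))

instance RatMod.isScalarTower {G : Type} [Group G] (V : RatMod G) :
    IsScalarTower ℚ (MonoidAlgebra ℚ G) V.carrier :=
  IsScalarTower.of_compHom ℚ (MonoidAlgebra ℚ G) V.carrier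

/-- The homomorphisms between two finitely generated `ℚ[G]`-modules. -/
abbrev RatMod.Hom {G : Type} [Group G] (V W : RatMod G) : Type :=
  V.carrier →ₗ[MonoidAlgebra ℚ G] W.carrier

instance RatMod.smulCommClass {G : Type} [Group G] (V : RatMod G) :
    SMulCommClass (MonoidAlgebra ℚ G) ℚ V.carrier :=
  IsScalarTower.to_smulCommClass'

instance RatMod.finite_hom {G : Type} [Group G] [Finite G] (V W : RatMod G) :
    Module.Finite ℚ (V.Hom W) := by
  have : Module.Finite ℚ (MonoidAlgebra ℚ G) :=
    Module.Finite.equiv (MonoidAlgebra.coeffLinearEquiv ℚ).symm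
  have hV : Module.Finite ℚ V.carrier := Module.Finite.trans (MonoidAlgebra ℚ G) _
  have hW : Module.Finite ℚ W.carrier := Module.Finite.trans (MonoidAlgebra ℚ G) _
  exact Module.Finite.of_injective
    (LinearMap.restrictScalarsₗ ℚ (MonoidAlgebra ℚ G) V.carrier W.carrier ℚ)
    (LinearMap.restrictScalars_injective ℚ)

/-- The dimension over `ℚ` of the space of homomorphisms. -/
def homDim {G : Type} [Group G] (V W : RatMod G) : ℕ := Module.finrank ℚ (V.Hom W)

/-- Additive maps between ℚ-vector spaces are automatically ℚ-linear, so Hom spaces need only be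
compared as abelian groups. -/
theorem finrank_rat_eq_of_addEquiv {E F : Type*} [AddCommGroup E] [AddCommGroup F] [Module ℚ E]
    [Module ℚ F] (e : E ≃+ F) : Module.finrank ℚ E = Module.finrank ℚ F :=
  (e.toLinearEquiv fun c x => map_ratCast_smul e ℚ ℚ c x).finrank_eq

section HomForm

variable {G : Type} [Group G]

theorem homDim_congr {V V' W W' : RatMod G} (e : V.carrier ≃ₗ[MonoidAlgebra ℚ G] V'.carrier)
    (e' : W.carrier ≃ₗ[MonoidAlgebra ℚ G] W'.carrier) : homDim V W = homDim V' W' :=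
  finrank_rat_eq_of_addEquiv
    { toFun := fun φ => e'.toLinearMap ∘ₗ φ ∘ₗ e.symm.toLinearMap
      invFun := fun φ => e'.symm.toLinearMap ∘ₗ φ ∘ₗ e.toLinearMap
      left_inv := fun φ => by ext; simp
      right_inv := fun φ => by ext; simp
      map_add' := fun φ ψ => by ext; simp }

theorem homDim_sum_left [Finite G] (V V' W : RatMod G) :
    homDim (V.sum V') W = homDim V W + homDim V' W := by
  rw [homDim, homDim, homDim, ← Module.finrank_prod]
  exact (finrank_rat_eq_of_addEquiv
    (LinearMap.coprodEquiv ℕ (R := MonoidAlgebra ℚ G) (M := V.carrier) (M₂ := V'.carrier)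
      (M₃ := W.carrier)).toAddEquiv).symm

theorem homDim_sum_right [Finite G] (V W W' : RatMod G) :
    homDim V (W.sum W') = homDim V W + homDim V W' := by
  rw [homDim, homDim, homDim, ← Module.finrank_prod]
  exact (finrank_rat_eq_of_addEquiv
    (LinearMap.prodEquiv ℕ (R := MonoidAlgebra ℚ G) (M := V.carrier) (M₂ := W.carrier)
      (M₃ := W'.carrier)).toAddEquiv).symm

theorem homDim_zero_left (W : RatMod G) : homDim (RatMod.zero G) W = 0 := by
  have : Subsingleton (RatMod.zero G).carrier := inferInstanceAs (Subsingleton PUnit)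
  exact Module.finrank_zero_of_subsingleton

theorem homDim_zero_right (V : RatMod G) : homDim V (RatMod.zero G) = 0 := by
  have : Subsingleton (RatMod.zero G).carrier := inferInstanceAs (Subsingleton PUnit)
  exact Module.finrank_zero_of_subsingleton

theorem subsingleton_of_homDim_self_eq_zero [Finite G] {V : RatMod G} (h : homDim V V = 0) :
    Subsingleton V.carrier := by
  have : Subsingleton (V.Hom V) := Module.finrank_zero_iff.1 h
  refine ⟨fun x y => ?_⟩
  have hid : (LinearMap.id : V.Hom V) = 0 := Subsingleton.elim _ _
  rw [← LinearMap.id_apply (R := MonoidAlgebra ℚ G) x,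
    ← LinearMap.id_apply (R := MonoidAlgebra ℚ G) y, hid]
  rfl

/-- A nonzero homomorphism splits off a nonzero common direct summand. -/
theorem exists_common_summand [Finite G] {V W : RatMod G} (φ : V.Hom W) (hφ : φ ≠ 0) :
    ∃ V' W' I : RatMod G, Nonempty (V.carrier ≃ₗ[MonoidAlgebra ℚ G] (V'.sum I).carrier) ∧
      Nonempty (W.carrier ≃ₗ[MonoidAlgebra ℚ G] (W'.sum I).carrier) ∧ homDim I I ≠ 0 := by
  -- Maschke's theorem supplies the complements; the common summand is the image of `φ`.
  obtain ⟨C, hC⟩ := exists_isCompl (LinearMap.ker φ)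
  obtain ⟨D, hD⟩ := exists_isCompl (LinearMap.range φ)
  refine ⟨⟨LinearMap.ker φ⟩, ⟨D⟩, ⟨LinearMap.range φ⟩, ⟨?_⟩, ⟨?_⟩, fun h => hφ ?_⟩
  · exact ((Submodule.prodEquivOfIsCompl _ _ hC).symm).trans (LinearEquiv.prodCongr
      (LinearEquiv.refl _ _) ((Submodule.quotientEquivOfIsCompl _ _ hC).symm.trans
        φ.quotKerEquivRange))
  · exact (Submodule.prodEquivOfIsCompl _ _ hD.symm).symm
  · have := subsingleton_of_homDim_self_eq_zero h
    refine LinearMap.ext fun x => ?_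
    exact congrArg Subtype.val (Subsingleton.elim (φ.rangeRestrict x) 0)

/-- The Hom form is positive definite: it detects isomorphism. -/
theorem nonempty_linearEquiv_of_homDim [Finite G] (V W : RatMod G)
    (h : homDim V V + homDim W W = homDim V W + homDim W V) :
    Nonempty (V.carrier ≃ₗ[MonoidAlgebra ℚ G] W.carrier) := by
  induction hd : homDim V V using Nat.strong_induction_on generalizing V W with
  | _ d ih =>
  subst hd
  -- If no nonzero map exists in either direction, `h` forces both endomorphism spaces to vanish and
  -- both modules are zero; otherwise a common summand splits off.
  suffices H : ∀ V' W' I : RatMod G,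
      Nonempty (V.carrier ≃ₗ[MonoidAlgebra ℚ G] (V'.sum I).carrier) →
      Nonempty (W.carrier ≃ₗ[MonoidAlgebra ℚ G] (W'.sum I).carrier) → homDim I I ≠ 0 →
      Nonempty (V.carrier ≃ₗ[MonoidAlgebra ℚ G] W.carrier) by
    by_cases h₁ : homDim V W = 0
    · by_cases h₂ : homDim W V = 0
      · have := subsingleton_of_homDim_self_eq_zero (V := V) (by omega)
        have := subsingleton_of_homDim_self_eq_zero (V := W) (by omega)
        exact ⟨LinearEquiv.ofSubsingleton _ _⟩
      · have : ∃ φ : W.Hom V, φ ≠ 0 := by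
          by_contra! hc
          have : Subsingleton (W.Hom V) := ⟨fun a b => by rw [hc a, hc b]⟩
          exact h₂ Module.finrank_zero_of_subsingleton
        obtain ⟨φ, hφ⟩ := this
        obtain ⟨W', V', I, hW, hV, hI⟩ := exists_common_summand φ hφ
        exact H V' W' I hV hW hI
    · have : ∃ φ : V.Hom W, φ ≠ 0 := by
        by_contra! hc
        have : Subsingleton (V.Hom W) := ⟨fun a b => by rw [hc a, hc b]⟩
        exact h₁ Module.finrank_zero_of_subsingleton
      obtain ⟨φ, hφ⟩ := this
      obtain ⟨V', W', I, hV, hW, hI⟩ := exists_common_summand φ hφ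
      exact H V' W' I hV hW hI
  rintro V' W' I ⟨e⟩ ⟨e'⟩ hI
  -- All terms involving `I` cancel in `h`, so `V'` and `W'` satisfy the same identity, while the
  -- self-pairing drops by at least `homDim I I`.
  have hVV := homDim_congr e e
  rw [homDim_congr e e, homDim_congr e e', homDim_congr e' e, homDim_congr e' e'] at h
  simp only [homDim_sum_left, homDim_sum_right] at h hVV
  obtain ⟨i⟩ := ih (homDim V' V') (by omega) V' W' (by omega) rfl
  exact ⟨e.trans ((LinearEquiv.prodCongr i (LinearEquiv.refl _ _)).trans e'.symm)⟩

/-- The Hom form on isomorphism classes. -/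
def homClass (G : Type) [Group G] [Finite G] : RatModClass G →+ RatModClass G →+ ℤ where
  toFun := Quotient.lift (fun V =>
    { toFun := Quotient.lift (fun W => (homDim V W : ℤ)) (by
        rintro W W' ⟨e⟩
        exact congrArg Nat.cast (homDim_congr (LinearEquiv.refl _ _) e))
      map_zero' := congrArg Nat.cast (homDim_zero_right V)
      map_add' := by
        rintro ⟨W⟩ ⟨W'⟩
        exact (congrArg Nat.cast (homDim_sum_right V W W')).trans (Nat.cast_add _ _) }) (by
    rintro V V' ⟨e⟩
    ext ⟨W⟩
    exact congrArg Nat.cast (homDim_congr e (LinearEquiv.refl _ _)))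
  map_zero' := by
    ext ⟨W⟩
    exact congrArg Nat.cast (homDim_zero_left W)
  map_add' := by
    rintro ⟨V⟩ ⟨V'⟩
    ext ⟨W⟩
    exact (congrArg Nat.cast (homDim_sum_left V V' W)).trans (Nat.cast_add _ _)

theorem homClass_cls [Finite G] (V W : RatMod G) : homClass G V.cls W.cls = homDim V W := rfl

/-! ### Extension of the form to Grothendieck groups -/

theorem GrothendieckAddGroup.lift_of {M A : Type*} [AddCommMonoid M] [AddCommGroup A]
    (f : M →+ A) (x : M) : GrothendieckAddGroup.lift f (GrothendieckAddGroup.of x) = f x :=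
  DFunLike.congr_fun (GrothendieckAddGroup.lift.symm_apply_apply f) x

theorem GrothendieckAddGroup.exists_sub {M : Type*} [AddCommMonoid M] (a : GrothendieckAddGroup M) :
    ∃ x y : M, a = GrothendieckAddGroup.of x - GrothendieckAddGroup.of y := by
  induction a using AddLocalization.ind with
  | _ q =>
  obtain ⟨x, y, hy⟩ := q
  refine ⟨x, y, ?_⟩
  change _ = AddLocalization.addMonoidOf _ x - AddLocalization.addMonoidOf _ (y : M)
  rw [← AddLocalization.mk_zero_eq_addMonoidOf_mk, ← AddLocalization.mk_zero_eq_addMonoidOf_mk,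
    GrothendieckAddGroup.mk_sub_mk]
  simp

/-- The Hom form on the representation group. -/
def homForm (G : Type) [Group G] [Finite G] : RepGroup G →+ RepGroup G →+ ℤ :=
  GrothendieckAddGroup.lift
    ((AddMonoidHom.mk' (GrothendieckAddGroup.lift (M := RatModClass G) (G := ℤ)) (by
      intro a b
      apply GrothendieckAddGroup.lift.symm.injective
      ext x
      change GrothendieckAddGroup.lift (a + b) (GrothendieckAddGroup.of x) =
        GrothendieckAddGroup.lift a (GrothendieckAddGroup.of x) +
          GrothendieckAddGroup.lift b (GrothendieckAddGroup.of x)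
      simp only [GrothendieckAddGroup.lift_of, AddMonoidHom.add_apply])).comp (homClass G))

theorem homForm_of_of [Finite G] (x y : RatModClass G) :
    homForm G (GrothendieckAddGroup.of x) (GrothendieckAddGroup.of y) = homClass G x y := by
  rw [homForm, GrothendieckAddGroup.lift_of]
  exact GrothendieckAddGroup.lift_of _ _

/-- The conclusion is an equality of isomorphism classes, not merely of their images in the
Grothendieck group, so it contains cancellation for direct sums. -/
theorem eq_of_homForm_self_eq_zero [Finite G] (x y : RatModClass G)
    (h : homForm G (GrothendieckAddGroup.of x - GrothendieckAddGroup.of y)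
      (GrothendieckAddGroup.of x - GrothendieckAddGroup.of y) = 0) : x = y := by
  induction x, y using Quotient.inductionOn₂ with
  | _ V W =>
  change homForm G (GrothendieckAddGroup.of V.cls - GrothendieckAddGroup.of W.cls)
      (GrothendieckAddGroup.of V.cls - GrothendieckAddGroup.of W.cls) = 0 at h
  simp only [map_sub, AddMonoidHom.sub_apply, homForm_of_of, homClass_cls] at h
  exact Quotient.sound (nonempty_linearEquiv_of_homDim V W (by omega))

theorem homForm_self_eq_zero_iff [Finite G] {r : RepGroup G} : homForm G r r = 0 ↔ r = 0 := by
  refine ⟨fun h => ?_, fun h => by simp [h]⟩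
  obtain ⟨x, y, rfl⟩ := GrothendieckAddGroup.exists_sub r
  rw [eq_of_homForm_self_eq_zero x y h, sub_self]

/-- The inclusion of the relative representation group is injective. -/
theorem grothendieckMap_subtype_injective [Finite G] (S : AddSubmonoid (RatModClass G)) :
    Function.Injective (grothendieckMap S.subtype) := by
  rw [injective_iff_map_eq_zero]
  intro a ha
  obtain ⟨x, y, rfl⟩ := GrothendieckAddGroup.exists_sub a
  simp only [grothendieckMap, map_sub, GrothendieckAddGroup.lift_of, AddMonoidHom.comp_apply] at ha
  -- The two classes already agree as isomorphism classes, so no stabilising summand has to be found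
  -- inside `S`.
  have := eq_of_homForm_self_eq_zero (x : RatModClass G) y (by
    rw [homForm_self_eq_zero_iff]; exact ha)
  rw [Subtype.ext this, sub_self]

end HomForm

/-! ### Generators of the Burnside group -/

/-- The `G`-set of cosets of a subgroup. -/
def cosetSet {G : Type} [Group G] [Finite G] (K : Subgroup G) : FinGSet G where
  carrier := G ⧸ K

theorem FinGSet.cls_eq {G : Type} [Group G] {X Y : FinGSet G} (e : X.carrier ≃ Y.carrier)
    (he : ∀ (g : G) (x : X.carrier), e (g • x) = g • e x) : X.cls = Y.cls :=
  Quotient.sound ⟨e, he⟩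

/-- A finite `G`-set decomposes as a point's orbit and the rest. -/
theorem FinGSet.exists_cls_eq_add {G : Type} [Group G] [Finite G] (X : FinGSet G)
    (x : X.carrier) : ∃ Y : FinGSet G, Nat.card Y.carrier < Nat.card X.carrier ∧
      X.cls = (cosetSet (MulAction.stabilizer G x)).cls + Y.cls ∧
      ∀ y : Y.carrier, ∃ z : X.carrier,
        MulAction.stabilizer G z = MulAction.stabilizer G y := by
  classical
  let C : SubMulAction G X.carrier :=
    { carrier := (MulAction.orbit G x)ᶜ
      smul_mem' := fun g y hy h => hy (by
        rwa [← MulAction.orbit_eq_iff, MulAction.orbit_smul, MulAction.orbit_eq_iff] at h) }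
  refine ⟨⟨C⟩, ?_, ?_, fun y => ⟨(y : X.carrier), ?_⟩⟩
  · exact Finite.card_subtype_lt (p := fun y => y ∈ C) (x := x)
      fun h => h (MulAction.mem_orbit_self x)
  · refine (FinGSet.cls_eq (X := (cosetSet (MulAction.stabilizer G x)).sum ⟨C⟩)
      (((MulAction.orbitEquivQuotientStabilizer G x).symm.sumCongr (Equiv.refl C)).trans
        (Equiv.Set.sumCompl (MulAction.orbit G x))) ?_).symm
    rintro g (a | y)
    · induction a using QuotientGroup.induction_on with
      | H a =>
        change ((MulAction.orbitEquivQuotientStabilizer G x).symm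
          ((g * a : G) : G ⧸ MulAction.stabilizer G x) : X.carrier) =
          g • ((MulAction.orbitEquivQuotientStabilizer G x).symm
            (a : G ⧸ MulAction.stabilizer G x) : X.carrier)
        rw [MulAction.orbitEquivQuotientStabilizer_symm_apply,
          MulAction.orbitEquivQuotientStabilizer_symm_apply, mul_smul]
    · rfl
  · ext g
    exact (Subtype.ext_iff (a1 := g • y) (a2 := y)).symm

/-- Induction on finite `G`-sets, adding one orbit at a time. -/
theorem FinGSet.cls_induction {G : Type} [Group G] [Finite G] (P : Subgroup G → Prop)
    (Q : FinGSetClass G → Prop) (zero : Q 0)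
    (add : ∀ K, P K → ∀ c, Q c → Q ((cosetSet K).cls + c)) (X : FinGSet G)
    (hX : ∀ x : X.carrier, P (MulAction.stabilizer G x)) : Q X.cls := by
  induction hd : Nat.card X.carrier using Nat.strong_induction_on generalizing X with
  | _ d ih =>
  subst hd
  rcases isEmpty_or_nonempty X.carrier with hE | ⟨⟨x⟩⟩
  · have : X.cls = 0 := FinGSet.cls_eq (Y := FinGSet.empty G) (Equiv.equivPEmpty X.carrier)
      fun g x => hE.elim x
    rwa [this]
  · obtain ⟨Y, hlt, hYX, hY⟩ := X.exists_cls_eq_add x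
    rw [hYX]
    refine add _ (hX x) _ (ih _ hlt Y (fun y => ?_) rfl)
    obtain ⟨z, hz⟩ := hY y
    exact hz ▸ hX z

/-- The number of points with a given stabilizer. -/
def stabCount {G : Type} [Group G] (K : Subgroup G) : FinGSetClass G →+ ℤ where
  toFun := Quotient.lift
    (fun X => (Nat.card {x : X.carrier // MulAction.stabilizer G x = K} : ℤ)) (by
      rintro X Y ⟨e, he⟩
      refine congrArg Nat.cast (Nat.card_congr (e.subtypeEquiv fun x => ?_))
      have : MulAction.stabilizer G (e x) = MulAction.stabilizer G x := by
        ext g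
        rw [MulAction.mem_stabilizer_iff, MulAction.mem_stabilizer_iff, ← he, e.apply_eq_iff_eq]
      rw [this])
  map_zero' := by
    change ((Nat.card {x : PEmpty // _} : ℕ) : ℤ) = 0
    simp
  map_add' := by
    rintro ⟨X⟩ ⟨Y⟩
    change ((Nat.card {z : X.carrier ⊕ Y.carrier // MulAction.stabilizer G z = K} : ℕ) : ℤ) =
      (Nat.card {x : X.carrier // _} : ℤ) + (Nat.card {y : Y.carrier // _} : ℤ)
    rw [← Nat.cast_add, ← Nat.card_sum]
    refine congrArg Nat.cast (Nat.card_congr (Equiv.subtypeSum.trans (Equiv.sumCongr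
      (Equiv.subtypeEquivRight fun x => ?_) (Equiv.subtypeEquivRight fun y => ?_))))
    · have : MulAction.stabilizer G (Sum.inl x : X.carrier ⊕ Y.carrier) =
          MulAction.stabilizer G x := by
        ext g
        exact Sum.inl_injective.eq_iff (a := g • x) (b := x)
      rw [this]
    · have : MulAction.stabilizer G (Sum.inr y : X.carrier ⊕ Y.carrier) =
          MulAction.stabilizer G y := by
        ext g
        exact Sum.inr_injective.eq_iff (a := g • y) (b := y)
      rw [this]

/-- Stabilizers along an orbit are conjugate, hence equal in an abelian group. This makes the matrix
of stabilizer counts on coset spaces diagonal. -/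
theorem stabilizer_coset {G : Type} [CommGroup G] (K : Subgroup G) (x : G ⧸ K) :
    MulAction.stabilizer G x = K := by
  induction x using QuotientGroup.induction_on with
  | H a =>
    ext g
    rw [MulAction.mem_stabilizer_iff]
    change ((g * a : G) : G ⧸ K) = (a : G ⧸ K) ↔ _
    rw [QuotientGroup.eq, ← inv_mem_iff]
    simp

open Classical in
theorem stabCount_coset {G : Type} [CommGroup G] [Finite G] (K L : Subgroup G) :
    stabCount K (cosetSet L).cls = if L = K then (Nat.card (G ⧸ L) : ℤ) else 0 := by
  change ((Nat.card {x : G ⧸ L // MulAction.stabilizer G x = K} : ℕ) : ℤ) = _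
  simp only [stabilizer_coset]
  split_ifs with h
  · rw [Nat.card_congr (Equiv.subtypeUnivEquiv fun _ => h)]
  · simp [h]

/-- Coset spaces of distinct subgroups are independent in the Burnside group. -/
theorem linearIndependent_coset {G : Type} [CommGroup G] [Finite G] {ι : Type*}
    (K : ι → Subgroup G) (hK : Function.Injective K) : LinearIndependent ℤ fun i =>
      (GrothendieckAddGroup.of (cosetSet (K i)).cls : BurnsideGroup G) := by
  classical
  rw [linearIndependent_iff]
  intro x hx
  ext j
  have h := congrArg (GrothendieckAddGroup.lift (stabCount (K j))) hx
  rw [Finsupp.linearCombination_apply, Finsupp.sum, map_sum, map_zero] at h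
  simp only [map_zsmul, GrothendieckAddGroup.lift_of, stabCount_coset, hK.eq_iff, smul_eq_mul,
    mul_ite, mul_zero, Finset.sum_ite_eq'] at h
  by_contra hj
  rw [if_pos (Finsupp.mem_support_iff.2 hj)] at h
  exact (mul_ne_zero hj (Nat.cast_ne_zero.2 Nat.card_pos.ne')) h

/-! ### Ranks of kernels -/

/-- Rank of a kernel, computed through a spanning family of independent vectors. -/
theorem kernel_rank {A R E ι κ : Type*} [AddCommGroup A] [AddCommGroup R] [AddCommGroup E]
    [Fintype ι] [Fintype κ] (f : A →+ R) (a : ι → A) (ha : LinearIndependent ℤ a)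
    (hs : ⊤ ≤ Submodule.span ℤ (Set.range a)) (v : ι → E)
    (hv : ∀ x : ι →₀ ℤ, f (Finsupp.linearCombination ℤ a x) = 0 ↔
      Finsupp.linearCombination ℤ v x = 0)
    (t : κ → ι) (ht : LinearIndependent ℤ (v ∘ t))
    (hspan : ∀ i, v i ∈ Submodule.span ℤ (Set.range (v ∘ t))) :
    Module.Free ℤ f.ker ∧ Module.Finite ℤ f.ker ∧
      Module.finrank ℤ f.ker + Fintype.card κ = Fintype.card ι := by
  let b := Module.Basis.mk ha hs
  let u := Finsupp.linearCombination ℤ v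
  have hb : ∀ x, b.repr.symm x = Finsupp.linearCombination ℤ a x := fun x => by
    rw [Module.Basis.repr_symm_apply, Module.Basis.coe_mk]
  -- By `hv`, coordinates in the basis `a` identify the kernel of `f` with the lattice of relations
  -- among the `v i`; as a subgroup of a finite free ℤ-module it is finite free.
  let e : LinearMap.ker u ≃+ f.ker := b.repr.symm.toAddEquiv.addSubgroupMap
    (LinearMap.ker u).toAddSubgroup |>.trans (AddEquiv.addSubgroupCongr (by
      ext y
      rw [AddSubgroup.mem_map, AddMonoidHom.mem_ker]
      constructor
      · rintro ⟨x, hx, rfl⟩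
        exact (congrArg f (hb x)).trans ((hv x).2 hx)
      · refine fun hy => ⟨b.repr y, (hv _).1 ?_, b.repr.symm_apply_apply y⟩
        rwa [← hb, b.repr.symm_apply_apply]))
  let e' : LinearMap.ker u ≃ₗ[ℤ] f.ker := e.toIntLinearEquiv
  refine ⟨Module.Free.of_equiv e', Module.Finite.equiv e', ?_⟩
  rw [← e'.finrank_eq]
  have hr : LinearMap.range u = Submodule.span ℤ (Set.range (v ∘ t)) := by
    rw [Finsupp.range_linearCombination]
    refine le_antisymm (Submodule.span_le.2 ?_)
      (Submodule.span_mono (Set.range_comp_subset_range _ _))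
    rintro _ ⟨i, rfl⟩
    exact hspan i
  -- Rank-nullity over ℤ: the image of `u` is free on `v ∘ t`.
  have h1 := Submodule.finrank_quotient_add_finrank (LinearMap.ker u)
  rw [u.quotKerEquivRange.finrank_eq, hr, finrank_span_eq_card ht, Module.finrank_finsupp_self] at h1
  omega

/-- The span of the coset spaces exhausts the Burnside group. -/
theorem top_le_span_coset {G : Type} [Group G] [Finite G] {ι : Type*} (K : ι → Subgroup G)
    (hK : Function.Surjective K) : ⊤ ≤ Submodule.span ℤ (Set.range fun i =>
      (GrothendieckAddGroup.of (cosetSet (K i)).cls : BurnsideGroup G)) := by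
  rintro a -
  suffices h : ∀ X : FinGSet G, (GrothendieckAddGroup.of X.cls : BurnsideGroup G) ∈
      Submodule.span ℤ (Set.range fun i =>
        (GrothendieckAddGroup.of (cosetSet (K i)).cls : BurnsideGroup G)) by
    obtain ⟨⟨X⟩, ⟨Y⟩, rfl⟩ := GrothendieckAddGroup.exists_sub a
    exact sub_mem (h X) (h Y)
  intro X
  refine FinGSet.cls_induction (fun _ => True) (fun c => GrothendieckAddGroup.of c ∈ _) ?_ ?_ X
    fun _ => trivial
  · rw [map_zero]
    exact zero_mem _
  · intro L _ c hc
    obtain ⟨i, rfl⟩ := hK L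
    rw [map_add]
    exact add_mem (Submodule.subset_span ⟨i, rfl⟩) hc

/-! ### Free coset spaces and comparison with the absolute groups -/

theorem cosetSet_isFreeOver {G H : Type} [CommGroup G] [CommGroup H] [Finite G] [Finite H]
    (K : Subgroup (G × H)) (hK : ∀ h : H, ((1, h) : G × H) ∈ K → h = 1) :
    (cosetSet K).IsFreeOver H := fun h x hx =>
  hK h ((stabilizer_coset K x).le (MulAction.mem_stabilizer_iff.2 hx))

/-- The span of the free coset spaces exhausts the relative Burnside group. -/
theorem top_le_span_relCoset {G H : Type} [CommGroup G] [CommGroup H] [Finite G] [Finite H]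
    {ι : Type*} (K : ι → Subgroup (G × H)) (hf : ∀ i, (cosetSet (K i)).IsFreeOver H)
    (hK : ∀ L : Subgroup (G × H), (∀ h : H, ((1, h) : G × H) ∈ L → h = 1) → ∃ i, K i = L) :
    ⊤ ≤ Submodule.span ℤ (Set.range fun i =>
      (GrothendieckAddGroup.of ⟨(cosetSet (K i)).cls, _, hf i, rfl⟩ : RelBurnside G H)) := by
  rintro a -
  suffices h : ∀ X : FinGSet (G × H), X.IsFreeOver H →
      ∃ hX : X.cls ∈ relFinGSetClass G H,
      (GrothendieckAddGroup.of ⟨X.cls, hX⟩ : RelBurnside G H) ∈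
      Submodule.span ℤ (Set.range fun i =>
        (GrothendieckAddGroup.of ⟨(cosetSet (K i)).cls, _, hf i, rfl⟩ : RelBurnside G H)) by
    obtain ⟨⟨_, X, hX, rfl⟩, ⟨_, Y, hY, rfl⟩, rfl⟩ := GrothendieckAddGroup.exists_sub a
    exact sub_mem (h X hX).2 (h Y hY).2
  intro X hX
  -- Freeness is a condition on point stabilizers, so it passes to every orbit split off in the
  -- induction.
  refine FinGSet.cls_induction (fun L => ∀ h : H, ((1, h) : G × H) ∈ L → h = 1)
    (fun c => ∃ hc : c ∈ relFinGSetClass G H,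
      (GrothendieckAddGroup.of ⟨c, hc⟩ : RelBurnside G H) ∈ Submodule.span ℤ _) ?_ ?_ X
    fun x h hx => hX h x hx
  · refine ⟨zero_mem _, ?_⟩
    have : (⟨0, zero_mem _⟩ : relFinGSetClass G H) = 0 := rfl
    rw [this, map_zero]
    exact zero_mem _
  · rintro L hL c ⟨hc, hc'⟩
    obtain ⟨i, rfl⟩ := hK L hL
    refine ⟨add_mem ⟨_, hf i, rfl⟩ hc, ?_⟩
    have : (⟨(cosetSet (K i)).cls + c, add_mem ⟨_, hf i, rfl⟩ hc⟩ : relFinGSetClass G H) =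
      ⟨(cosetSet (K i)).cls, _, hf i, rfl⟩ + ⟨c, hc⟩ := rfl
    rw [this, map_add]
    exact add_mem (Submodule.subset_span ⟨i, rfl⟩) hc'

theorem grothendieckMap_of {M N : Type*} [AddCommMonoid M] [AddCommMonoid N] (φ : M →+ N) (x : M) :
    grothendieckMap φ (GrothendieckAddGroup.of x) = GrothendieckAddGroup.of (φ x) :=
  GrothendieckAddGroup.lift_of _ _

/-- Free coset spaces are sent to coset spaces by the inclusion of Burnside groups. -/
theorem of_coset_eq_grothendieckMap_comp {G H : Type} [CommGroup G] [CommGroup H] [Finite G]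
    [Finite H] {ι : Type*} (K : ι → Subgroup (G × H))
    (hf : ∀ i, (cosetSet (K i)).IsFreeOver H) :
    (fun i => (GrothendieckAddGroup.of (cosetSet (K i)).cls : BurnsideGroup (G × H))) =
      (grothendieckMap (relFinGSetClass G H).subtype).toIntLinearMap ∘ fun i =>
        (GrothendieckAddGroup.of ⟨(cosetSet (K i)).cls, _, hf i, rfl⟩ : RelBurnside G H) :=
  funext fun i => (grothendieckMap_of (relFinGSetClass G H).subtype
    ⟨(cosetSet (K i)).cls, _, hf i, rfl⟩).symm

/-- Independence is detected after mapping to the absolute Burnside group. -/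
theorem linearIndependent_relCoset {G H : Type} [CommGroup G] [CommGroup H] [Finite G] [Finite H]
    {ι : Type*} (K : ι → Subgroup (G × H)) (hf : ∀ i, (cosetSet (K i)).IsFreeOver H)
    (hK : Function.Injective K) : LinearIndependent ℤ fun i =>
      (GrothendieckAddGroup.of ⟨(cosetSet (K i)).cls, _, hf i, rfl⟩ : RelBurnside G H) := by
  refine LinearIndependent.of_comp
    (grothendieckMap (relFinGSetClass G H).subtype).toIntLinearMap ?_
  have h := linearIndependent_coset K hK
  rw [of_coset_eq_grothendieckMap_comp K hf] at h
  exact h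

/-- Relative and absolute permutation modules agree in the representation group. -/
theorem grothendieckMap_subtype_relBurnsideMap {G H : Type} [Group G] [Group H]
    (a : RelBurnside G H) :
    grothendieckMap (relRatModClass G H).subtype (relBurnsideMap G H a) =
      burnsideMap (G × H) (grothendieckMap (relFinGSetClass G H).subtype a) := by
  obtain ⟨x, y, rfl⟩ := GrothendieckAddGroup.exists_sub a
  simp only [relBurnsideMap, burnsideMap, map_sub, grothendieckMap_of]
  rfl

/-- If the Hom form on coset modules is a Gram matrix, its vectors detect the Burnside kernel. -/
theorem burnsideMap_eq_zero_iff {G : Type} [Group G] [Finite G] {ι D : Type*} [Fintype D]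
    (K : ι → Subgroup G) (v : ι → D → ℤ)
    (hv : ∀ i j, (homDim (permMod (cosetSet (K i))) (permMod (cosetSet (K j))) : ℤ) =
      ∑ φ, v i φ * v j φ) (x : ι →₀ ℤ) :
    burnsideMap G (Finsupp.linearCombination ℤ
      (fun i => (GrothendieckAddGroup.of (cosetSet (K i)).cls : BurnsideGroup G)) x) = 0 ↔
    Finsupp.linearCombination ℤ v x = 0 := by
  have key : ∀ x y : ι →₀ ℤ, homForm G (burnsideMap G (Finsupp.linearCombination ℤ
      (fun i => (GrothendieckAddGroup.of (cosetSet (K i)).cls : BurnsideGroup G)) x))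
      (burnsideMap G (Finsupp.linearCombination ℤ
      (fun i => (GrothendieckAddGroup.of (cosetSet (K i)).cls : BurnsideGroup G)) y)) =
      ∑ φ, Finsupp.linearCombination ℤ v x φ * Finsupp.linearCombination ℤ v y φ := by
    intro x y
    induction x using Finsupp.induction_linear with
    | zero => simp
    | add x x' hx hx' =>
      simp only [map_add, AddMonoidHom.add_apply, Pi.add_apply, add_mul, Finset.sum_add_distrib,
        hx, hx']
    | single i c =>
      induction y using Finsupp.induction_linear with
      | zero => simp
      | add y y' hy hy' =>
        simp only [map_add, Pi.add_apply, mul_add, Finset.sum_add_distrib, hy, hy']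
      | single j d =>
        simp only [Finsupp.linearCombination_single, map_zsmul, burnsideMap, grothendieckMap_of,
          AddMonoidHom.smul_apply, homForm_of_of, Pi.smul_apply, smul_eq_mul]
        have : homClass G (permClass G (cosetSet (K i)).cls) (permClass G (cosetSet (K j)).cls) =
          ∑ φ, v i φ * v j φ := hv i j
        rw [this, Finset.mul_sum, Finset.mul_sum]
        exact Finset.sum_congr rfl fun φ _ => by ring
  -- The self-pairing is a sum of integer squares, so it vanishes only if every coordinate does.
  rw [← homForm_self_eq_zero_iff, key,
    Finset.sum_eq_zero_iff_of_nonneg fun φ _ => mul_self_nonneg _]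
  simp [funext_iff]

/-! ### The Hom form on permutation modules -/

section PermHom

variable {G : Type} [Group G]

/-- The basis vector of a permutation module at a point. -/
def permMod.pt (X : FinGSet G) (x : X.carrier) : (permMod X).carrier :=
  (Representation.ofMulAction ℚ G X.carrier).asModuleEquiv.symm (MonoidAlgebra.single x 1)

/-- The coordinate function of a vector in a permutation module. -/
def permMod.coeff {X : FinGSet G} (v : (permMod X).carrier) : X.carrier →₀ ℚ :=
  ((Representation.ofMulAction ℚ G X.carrier).asModuleEquiv v).coeff

theorem permMod.coeff_injective (X : FinGSet G) :
    Function.Injective (permMod.coeff (X := X)) :=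
  MonoidAlgebra.coeff_injective.comp
    (Representation.ofMulAction ℚ G X.carrier).asModuleEquiv.injective

theorem coeff_asModuleEquiv_single_smul {X : Type} [MulAction G X] (g : G) (c : ℚ)
    (v : (Representation.ofMulAction ℚ G X).asModule) (x : X) :
    ((Representation.ofMulAction ℚ G X).asModuleEquiv (MonoidAlgebra.single g c • v)).coeff x =
      c * ((Representation.ofMulAction ℚ G X).asModuleEquiv v).coeff (g⁻¹ • x) := by
  rw [Representation.asModuleEquiv_map_smul, Representation.asAlgebraHom_single,
    LinearMap.smul_apply, MonoidAlgebra.coeff_smul, Finsupp.smul_apply,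
    Representation.coeff_ofMulAction, smul_eq_mul]

theorem permMod.coeff_single_smul {X : FinGSet G} (g : G) (c : ℚ) (v : (permMod X).carrier)
    (x : X.carrier) : permMod.coeff (MonoidAlgebra.single g c • v) x =
      c * permMod.coeff v (g⁻¹ • x) := by
  exact coeff_asModuleEquiv_single_smul g c v x

theorem permMod.single_smul_pt {X : FinGSet G} (g : G) (c : ℚ) (x : X.carrier) :
    MonoidAlgebra.single g c • permMod.pt X x =
      (Representation.ofMulAction ℚ G X.carrier).asModuleEquiv.symm
        (MonoidAlgebra.single (g • x) c) := by
  refine (single_smul_single g c 1 x).trans ?_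
  rw [mul_one]

theorem permMod.hom_ext {X : FinGSet G} {W : RatMod G} {φ ψ : (permMod X).Hom W}
    (h : ∀ x, φ (permMod.pt X x) = ψ (permMod.pt X x)) : φ = ψ := by
  refine LinearMap.ext fun v => ?_
  obtain ⟨v, rfl⟩ := (Representation.ofMulAction ℚ G X.carrier).asModuleEquiv.symm.surjective v
  induction v using MonoidAlgebra.induction_linear with
  | zero => exact (map_zero φ).trans (map_zero ψ).symm
  | add v w hv hw =>
    rw [map_add]
    exact (map_add φ _ _).trans ((congrArg₂ (· + ·) hv hw).trans (map_add ψ _ _).symm)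
  | single x r =>
    have := permMod.single_smul_pt 1 r x
    rw [one_smul] at this
    rw [← this]
    exact (map_smul φ _ _).trans ((congrArg _ (h x)).trans (map_smul ψ _ _).symm)

/-- An equivariant function extends to a homomorphism out of the permutation module. -/
theorem permMod.exists_hom {X : FinGSet G} {W : RatMod G} (w : X.carrier → W.carrier)
    (hw : ∀ (g : G) x, w (g • x) = MonoidAlgebra.single g (1 : ℚ) • w x) :
    ∃ φ : (permMod X).Hom W, ∀ x, φ (permMod.pt X x) = w x := by
  let L : (Representation.ofMulAction ℚ G X.carrier).asModule →ₗ[ℚ] W.carrier :=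
    (Finsupp.linearCombination ℚ w) ∘ₗ (MonoidAlgebra.coeffLinearEquiv ℚ).toLinearMap ∘ₗ
      (Representation.ofMulAction ℚ G X.carrier).asModuleEquiv.toLinearMap
  have hL : ∀ x r, L ((Representation.ofMulAction ℚ G X.carrier).asModuleEquiv.symm
      (MonoidAlgebra.single x r)) = r • w x := by
    intro x r
    simp [L]
  refine ⟨{ L.toAddMonoidHom with map_smul' := map_smul_of_single L.toAddMonoidHom ?_ }, ?_⟩
  · intro g c r x
    change L _ = _ • L _
    rw [hL, hL, hw, smul_comm (MonoidAlgebra.single g c) r, mul_comm, mul_smul, ← smul_assoc c,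
      MonoidAlgebra.smul_single, smul_eq_mul, mul_one]
  · intro x
    exact (hL x 1).trans (one_smul _ _)

/-- Homomorphisms between permutation modules are functions on the orbits of the product. -/
theorem homDim_permMod (X Y : FinGSet G) : homDim (permMod X) (permMod Y) =
    Nat.card (MulAction.orbitRel.Quotient G (X.carrier × Y.carrier)) := by
  have hsmul : ∀ (φ : (permMod X).Hom (permMod Y)) (g : G) (x : X.carrier),
      φ (permMod.pt X (g • x)) = MonoidAlgebra.single g (1 : ℚ) • φ (permMod.pt X x) := by
    intro φ g x
    rw [← map_smul, permMod.single_smul_pt]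
    rfl
  -- A homomorphism is recorded by its matrix entries; equivariance makes them constant on the
  -- orbits of pairs.
  let F : (permMod X).Hom (permMod Y) →+
      (MulAction.orbitRel.Quotient G (X.carrier × Y.carrier) → ℚ) :=
    { toFun := fun φ => Quotient.lift (fun q => permMod.coeff (φ (permMod.pt X q.1)) q.2) (by
        rintro _ ⟨x, y⟩ ⟨g, rfl⟩
        change permMod.coeff (φ (permMod.pt X (g • x))) (g • y) = _
        rw [hsmul, permMod.coeff_single_smul, one_mul, inv_smul_smul])
      map_zero' := by
        ext ⟨q⟩
        rfl
      map_add' := fun φ ψ => by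
        ext ⟨q⟩
        rfl }
  have hF : ∀ φ x y, F φ (Quotient.mk _ (x, y)) = permMod.coeff (φ (permMod.pt X x)) y :=
    fun _ _ _ => rfl
  have hbij : Function.Bijective F := by
    constructor
    · intro φ ψ h
      refine permMod.hom_ext fun x => permMod.coeff_injective Y (Finsupp.ext fun y => ?_)
      rw [← hF, h, hF]
    · intro c
      obtain ⟨φ, hφ⟩ := permMod.exists_hom (X := X) (W := permMod Y)
        (fun x => (Representation.ofMulAction ℚ G Y.carrier).asModuleEquiv.symm
          (MonoidAlgebra.ofCoeff (Finsupp.equivFunOnFinite.symm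
            fun y => c (Quotient.mk _ (x, y))))) (by
        intro g x
        refine permMod.coeff_injective Y (Finsupp.ext fun y => ?_)
        refine Eq.trans ?_ ((permMod.coeff_single_smul g 1 _ y).trans (one_mul _)).symm
        change c (Quotient.mk _ (g • x, y)) = c (Quotient.mk _ (x, g⁻¹ • y))
        refine congrArg c (Quotient.sound ⟨g, ?_⟩)
        change (g • x, g • g⁻¹ • y) = _
        rw [smul_inv_smul])
      refine ⟨φ, funext ?_⟩
      rintro ⟨x, y⟩
      refine (hF φ x y).trans ?_
      rw [hφ]
      rfl
  have := Fintype.ofFinite (MulAction.orbitRel.Quotient G (X.carrier × Y.carrier))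
  rw [homDim, finrank_rat_eq_of_addEquiv (AddEquiv.ofBijective F hbij),
    Module.finrank_fintype_fun_eq_card,
    Nat.card_eq_fintype_card]

/-- For an abelian group, the Hom form on coset spaces is an index. -/
theorem homDim_coset {G : Type} [CommGroup G] [Finite G] (K L : Subgroup G) :
    homDim (permMod (cosetSet K)) (permMod (cosetSet L)) = Nat.card (G ⧸ (K ⊔ L)) := by
  rw [homDim_permMod]
  -- Each orbit contains a pair with first coordinate the trivial coset; its second coordinate is
  -- determined up to translation by K, hence is a class modulo K ⊔ L.
  refine (Nat.card_congr (Equiv.ofBijective (fun a : G ⧸ (K ⊔ L) => ?_) ?_)).symm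
  · exact Quotient.lift (fun a : G => (Quotient.mk _ (((1 : G) : G ⧸ K), (a : G ⧸ L)) :
      MulAction.orbitRel.Quotient G ((G ⧸ K) × (G ⧸ L)))) (by
      intro a b hab
      have hab : a⁻¹ * b ∈ K ⊔ L := QuotientGroup.leftRel_apply.1 hab
      obtain ⟨k, hk, l, hl, hkl⟩ := Subgroup.mem_sup.1 hab
      refine Quotient.sound ⟨k⁻¹, ?_⟩
      refine Prod.ext ?_ ?_
      · change ((k⁻¹ * 1 : G) : G ⧸ K) = ((1 : G) : G ⧸ K)
        rw [QuotientGroup.eq]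
        simpa using hk
      · change ((k⁻¹ * b : G) : G ⧸ L) = (a : G ⧸ L)
        rw [QuotientGroup.eq, ← inv_mem_iff]
        have : (k⁻¹ * b)⁻¹ * a = l⁻¹ := by
          have : b = a * (k * l) := by rw [hkl]; group
          rw [this, mul_left_comm, inv_mul_cancel_left, mul_inv, mul_right_comm, inv_mul_cancel,
            one_mul]
        rw [this]
        simpa using hl) a
  · constructor
    · rintro ⟨a⟩ ⟨b⟩ h
      obtain ⟨g, hg⟩ := Quotient.exact h
      have h1 : ((g * 1 : G) : G ⧸ K) = ((1 : G) : G ⧸ K) := congrArg Prod.fst hg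
      have h2 : ((g * b : G) : G ⧸ L) = (a : G ⧸ L) := congrArg Prod.snd hg
      rw [QuotientGroup.eq] at h1 h2
      refine QuotientGroup.eq.2 ?_
      have : a⁻¹ * b = ((g * 1)⁻¹ * 1) * ((g * b)⁻¹ * a)⁻¹ := by
        rw [mul_one, mul_one, mul_inv_rev, inv_inv, mul_left_comm a⁻¹, inv_mul_cancel_left]
      rw [this]
      exact mul_mem (Subgroup.mem_sup_left h1) (inv_mem (Subgroup.mem_sup_right h2))
    · rintro ⟨⟨⟨a⟩, ⟨b⟩⟩⟩
      refine ⟨((a⁻¹ * b : G) : G ⧸ (K ⊔ L)), Quotient.sound ⟨a⁻¹, ?_⟩⟩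
      refine Prod.ext ?_ ?_
      · change ((a⁻¹ * a : G) : G ⧸ K) = ((1 : G) : G ⧸ K)
        rw [inv_mul_cancel]
      · rfl

end PermHom

/-! ### Annihilator indicators of subspaces -/

section Annihilator

variable {F V : Type} [Field F] [AddCommGroup V] [Module F V]

open Classical in
/-- The indicator function of the annihilator of a subspace. -/
def annInd (W : Submodule F V) (φ : Module.Dual F V) : ℤ := if W ≤ LinearMap.ker φ then 1 else 0

/-- Inner products of indicators thus become counts of functionals killing a sum, which matches the
index formula for the Hom form. -/
theorem annInd_mul (W W' : Submodule F V) (φ : Module.Dual F V) :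
    annInd W φ * annInd W' φ = annInd (W ⊔ W') φ := by
  simp only [annInd, sup_le_iff]
  split_ifs <;> simp_all

theorem annInd_top (φ : Module.Dual F V) [Decidable (φ = 0)] :
    annInd ⊤ φ = if φ = 0 then 1 else 0 := by
  simp only [annInd, top_le_iff, LinearMap.ker_eq_top]

/-- The hyperplanes of a vector space. -/
abbrev Hyperplane (F V : Type) [Field F] [AddCommGroup V] [Module F V] : Type :=
  {L : Submodule F V // Module.finrank F L + 1 = Module.finrank F V}

/-! ### Subspaces disjoint from a line -/

variable (H : Submodule F V)

/-- The trace functional vanishing on annihilator indicators of subspaces disjoint from `H`. -/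
def freeTrace [Fintype (Module.Dual F V)] : (Module.Dual F V → ℤ) →ₗ[ℤ] ℤ :=
  ∑ φ, ((Nat.card F : ℤ) * annInd H φ - 1) • LinearMap.proj φ

/-- Only the zero functional contributes, with value |F| - 1. Hence `annInd ⊤` is outside the span
in the relative case. -/
theorem freeTrace_annInd_top [Finite F] [Fintype (Module.Dual F V)] :
    freeTrace H (annInd ⊤) ≠ 0 := by
  classical
  have h1 : freeTrace H (annInd ⊤) = Nat.card F - 1 := by
    rw [freeTrace, LinearMap.sum_apply, Finset.sum_eq_single 0]
    · simp [annInd]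
    · intro φ _ hφ
      rw [LinearMap.smul_apply, LinearMap.proj_apply, annInd_top, if_neg hφ, smul_zero]
    · simp
  have := Finite.one_lt_card (α := F)
  rw [h1]
  omega

open Classical in
/-- A subspace disjoint from the line `H` attached to a hyperplane, using a complement `C` of `H`. -/
def sliceSubspace (C : Submodule F V) (L : Hyperplane F V) : Submodule F V :=
  if H ≤ (L : Submodule F V) then C ⊓ L else L

variable {H} {C : Submodule F V}

/-- By the modular law, a slice still determines its hyperplane. -/
theorem sliceSubspace_sup (hC : IsCompl C H) {L : Hyperplane F V} (hL : H ≤ (L : Submodule F V)) :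
    sliceSubspace H C L ⊔ H = L := by
  rw [sliceSubspace, if_pos hL, inf_comm, inf_sup_assoc_of_le _ hL, hC.sup_eq_top, inf_top_eq]

theorem sliceSubspace_of_not_le {L : Hyperplane F V} (hL : ¬ H ≤ (L : Submodule F V)) :
    sliceSubspace H C L = L := if_neg hL

theorem sliceSubspace_le (L : Hyperplane F V) : sliceSubspace H C L ≤ L := by
  rw [sliceSubspace]
  split_ifs
  · exact inf_le_right
  · exact le_rfl

theorem disjoint_sliceSubspace (hH : Module.finrank F H = 1) (hC : IsCompl C H)
    (L : Hyperplane F V) : Disjoint (sliceSubspace H C L) H := by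
  rw [sliceSubspace]
  split_ifs with hL
  · exact hC.disjoint.mono_left inf_le_left
  · exact ((Submodule.isAtom_iff_finrank_eq_one.2 hH).not_le_iff_disjoint.1 hL).symm

variable [FiniteDimensional F V]

theorem Hyperplane.eq_of_le {L L' : Hyperplane F V} (h : (L : Submodule F V) ≤ L') : L = L' :=
  Subtype.ext (Submodule.eq_of_le_of_finrank_eq h (by have := L.2; have := L'.2; omega))

/-- The kernel of a nonzero functional. -/
def Hyperplane.ker (φ : Module.Dual F V) (hφ : φ ≠ 0) : Hyperplane F V :=
  ⟨LinearMap.ker φ, Module.Dual.finrank_ker_add_one_of_ne_zero hφ⟩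

theorem Hyperplane.exists_ker (L : Hyperplane F V) :
    ∃ φ : Module.Dual F V, φ ≠ 0 ∧ LinearMap.ker φ = L := by
  have hlt : (L : Submodule F V) < ⊤ := by
    refine lt_top_iff_ne_top.2 fun h => ?_
    have := L.2
    rw [h, finrank_top] at this
    omega
  obtain ⟨φ, hφ, hL⟩ := Submodule.exists_le_ker_of_lt_top _ hlt
  exact ⟨φ, hφ, congrArg Subtype.val (Hyperplane.eq_of_le (L' := Hyperplane.ker φ hφ) hL).symm⟩

/-- The difference is the indicator of the functionals with kernel exactly `L`, a punctured line in
the dual. These sets partition the nonzero functionals. -/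
theorem annInd_hyperplane_sub_top (L : Hyperplane F V) (φ : Module.Dual F V) [Decidable (φ = 0)]
    [DecidableEq (Hyperplane F V)] :
    annInd (L : Submodule F V) φ - annInd ⊤ φ =
      if h : φ = 0 then 0 else if L = Hyperplane.ker φ h then 1 else 0 := by
  rw [annInd_top]
  by_cases h : φ = 0
  · simp [h, annInd]
  · have : (L : Submodule F V) ≤ LinearMap.ker φ ↔ L = Hyperplane.ker φ h :=
      ⟨fun hL => Hyperplane.eq_of_le hL, fun hL => (congrArg Subtype.val hL).le⟩
    simp only [h, annInd, this, if_false, dif_neg, sub_zero, not_false_eq_true]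

open Classical in
/-- Möbius-type expansion of an annihilator indicator in terms of hyperplanes. -/
theorem annInd_eq_top_add_sum [Fintype (Hyperplane F V)] (K : Submodule F V) :
    annInd K = annInd ⊤ + ∑ L : Hyperplane F V,
      if K ≤ (L : Submodule F V) then (annInd (L : Submodule F V) - annInd ⊤) else 0 := by
  ext φ
  have : ∀ L : Hyperplane F V, (if K ≤ (L : Submodule F V) then
      (annInd (L : Submodule F V) - annInd ⊤) else 0 : Module.Dual F V → ℤ) φ =
      if h : φ = 0 then 0 else if L = Hyperplane.ker φ h then
        (if K ≤ LinearMap.ker φ then 1 else 0) else 0 := by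
    intro L
    rw [ite_apply, Pi.sub_apply, annInd_hyperplane_sub_top, Pi.zero_apply]
    by_cases h : φ = 0
    · simp [h]
    · by_cases hL : L = Hyperplane.ker φ h
      · subst hL
        simp [h, Hyperplane.ker]
      · simp [h, hL]
  rw [Pi.add_apply, Finset.sum_apply, Finset.sum_congr rfl fun L _ => this L, annInd_top]
  by_cases h : φ = 0
  · simp [h, annInd]
  · simp [h, annInd]

/-- The subspaces of codimension at most one have independent annihilator indicators. -/
theorem linearIndependent_annInd [Finite F] : LinearIndependent ℤ
    fun W : {W : Submodule F V // Module.finrank F V ≤ Module.finrank F W + 1} =>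
      annInd (W : Submodule F V) := by
  classical
  have : Finite V := Module.finite_of_finite F
  have := Fintype.ofFinite (Submodule F V)
  rw [Fintype.linearIndependent_iff]
  intro c hc
  -- Evaluation at a functional with kernel `W` isolates the coefficient of a hyperplane `W`;
  -- evaluation at 0 then isolates that of `⊤`.
  have hyp : ∀ W : {W : Submodule F V // Module.finrank F V ≤ Module.finrank F W + 1},
      (W : Submodule F V) ≠ ⊤ → c W = 0 := by
    intro W hW
    have hlt : Module.finrank F (W : Submodule F V) < Module.finrank F V :=
      Submodule.finrank_lt hW
    obtain ⟨φ, -, hφ⟩ := Hyperplane.exists_ker (F := F) (V := V)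
      ⟨W, le_antisymm hlt W.2⟩
    have h := congrFun hc φ
    rw [Finset.sum_apply, Finset.sum_eq_single W] at h
    · simpa [annInd, hφ] using h
    · intro W' _ hne
      have : ¬ (W' : Submodule F V) ≤ LinearMap.ker φ := fun hle => hne (Subtype.ext
        (Submodule.eq_of_le_of_finrank_le (hle.trans hφ.le)
          (by have := W'.2; exact Nat.le_of_lt_succ (hlt.trans_le this))))
      simp [annInd, this]
    · simp
  intro W
  by_cases hW : (W : Submodule F V) = ⊤
  · have h := congrFun hc 0
    rw [Finset.sum_apply, Finset.sum_eq_single W] at h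
    · simpa [annInd] using h
    · intro W' _ hne
      rw [hyp W' fun h => hne (Subtype.ext (h.trans hW.symm)), zero_smul, Pi.zero_apply]
    · simp
  · exact hyp W hW

theorem annInd_mem_span [Finite F] (K : Submodule F V) : annInd K ∈ Submodule.span ℤ (Set.range
    fun W : {W : Submodule F V // Module.finrank F V ≤ Module.finrank F W + 1} =>
      annInd (W : Submodule F V)) := by
  have : Finite V := Module.finite_of_finite F
  have := Fintype.ofFinite (Hyperplane F V)
  rw [annInd_eq_top_add_sum K]
  have htop : annInd ⊤ ∈ Submodule.span ℤ (Set.range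
    fun W : {W : Submodule F V // Module.finrank F V ≤ Module.finrank F W + 1} =>
      annInd (W : Submodule F V)) :=
    Submodule.subset_span ⟨⟨⊤, by rw [finrank_top]; omega⟩, rfl⟩
  refine add_mem htop (sum_mem fun L _ => ?_)
  split_ifs
  · exact sub_mem (Submodule.subset_span ⟨⟨L, L.2.ge⟩, rfl⟩) htop
  · exact zero_mem _

/-- Counting functionals: the annihilator of `W` has as many elements as `V ⧸ W`. -/
theorem sum_annInd [Finite F] [Fintype (Module.Dual F V)] (W : Submodule F V) :
    ∑ φ, annInd W φ = Nat.card (V ⧸ W) := by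
  classical
  have h1 : ∑ φ, annInd W φ = (Nat.card W.dualAnnihilator : ℤ) := by
    rw [Nat.card_eq_fintype_card, Fintype.card_subtype, Finset.card_filter, Nat.cast_sum]
    refine Finset.sum_congr rfl fun φ _ => ?_
    have : φ ∈ W.dualAnnihilator ↔ W ≤ LinearMap.ker φ := Submodule.mem_dualAnnihilator _
    by_cases h : W ≤ LinearMap.ker φ <;> simp [annInd, this, h]
  rw [h1, Module.natCard_eq_pow_finrank (K := F), Module.natCard_eq_pow_finrank (K := F) (V := V ⧸ W),
    (Subspace.finrank_add_finrank_dualAnnihilator_eq W |> fun h => by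
      have := Submodule.finrank_quotient_add_finrank W; omega :
      Module.finrank F W.dualAnnihilator = Module.finrank F (V ⧸ W))]

/-- Adding the line `H` to a disjoint `K` lowers the codimension by one, so |F| · |V/(K ⊔ H)| =
|V/K|. -/
theorem freeTrace_annInd [Finite F] [Fintype (Module.Dual F V)] (hH : Module.finrank F H = 1)
    {K : Submodule F V} (hK : Disjoint K H) : freeTrace H (annInd K) = 0 := by
  have h1 : freeTrace H (annInd K) =
      Nat.card F * ∑ φ, annInd (K ⊔ H) φ - ∑ φ, annInd K φ := by
    rw [freeTrace, LinearMap.sum_apply, Finset.mul_sum, ← Finset.sum_sub_distrib]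
    refine Finset.sum_congr rfl fun φ _ => ?_
    rw [← annInd_mul, LinearMap.smul_apply, LinearMap.proj_apply, smul_eq_mul]
    ring
  have h2 := Submodule.finrank_sup_add_finrank_inf_eq K H
  rw [hK.eq_bot, finrank_bot, hH] at h2
  have h3 := Submodule.finrank_quotient_add_finrank K
  have h4 := Submodule.finrank_quotient_add_finrank (K ⊔ H)
  rw [h1, sum_annInd, sum_annInd, Module.natCard_eq_pow_finrank (K := F) (V := V ⧸ K),
    Module.natCard_eq_pow_finrank (K := F) (V := V ⧸ (K ⊔ H)),
    show Module.finrank F (V ⧸ K) = Module.finrank F (V ⧸ (K ⊔ H)) + 1 by omega]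
  push_cast
  ring

/-- Evaluation at functionals with prescribed kernels gives a triangular system once the hyperplanes
containing `H` are treated first. -/
theorem linearIndependent_annInd_slice [Finite F] (hC : IsCompl C H) :
    LinearIndependent ℤ fun L : Hyperplane F V => annInd (sliceSubspace H C L) := by
  classical
  have : Finite V := Module.finite_of_finite F
  have := Fintype.ofFinite (Hyperplane F V)
  rw [Fintype.linearIndependent_iff]
  intro c hc
  have hsup : ∀ M : Hyperplane F V, H ≤ (M : Submodule F V) → c M = 0 := by
    intro M hM
    obtain ⟨φ, -, hφ⟩ := M.exists_ker
    have h := congrFun hc φ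
    rw [Finset.sum_apply, Finset.sum_eq_single M] at h
    · simpa [annInd, hφ, sliceSubspace_le] using h
    · intro L _ hne
      have : ¬ sliceSubspace H C L ≤ LinearMap.ker φ := by
        rw [hφ]
        -- Since `M` contains `H`, it contains the sum of `H` and the slice, hence all of `L`.
        intro hle
        by_cases hL : H ≤ (L : Submodule F V)
        · exact hne (Hyperplane.eq_of_le ((sliceSubspace_sup hC hL).ge.trans (sup_le hle hM)))
        · rw [sliceSubspace_of_not_le hL] at hle
          exact hne (Hyperplane.eq_of_le hle)
      simp [annInd, this]
    · simp
  intro M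
  by_cases hM : H ≤ (M : Submodule F V)
  · exact hsup M hM
  · obtain ⟨φ, -, hφ⟩ := M.exists_ker
    have h := congrFun hc φ
    rw [Finset.sum_apply, Finset.sum_eq_single M] at h
    · simpa [annInd, hφ, sliceSubspace_le] using h
    · intro L _ hne
      -- A slice of some `L ⊇ H` may well lie in `M`, but its coefficient is already known to
      -- vanish.
      by_cases hL : H ≤ (L : Submodule F V)
      · rw [hsup L hL, zero_smul, Pi.zero_apply]
      · have : ¬ (L : Submodule F V) ≤ LinearMap.ker φ := by
          rw [hφ]
          exact fun hle => hne (Hyperplane.eq_of_le hle)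
        rw [sliceSubspace_of_not_le hL]
        simp [annInd, this]
    · simp

/-- Adjoining `annInd ⊤` to the slices makes every indicator reachable over ℤ; `freeTrace` then
shows that `annInd ⊤` occurs with coefficient zero when `K` is disjoint from `H`. -/
theorem annInd_mem_span_slice [Finite F] (hH : Module.finrank F H = 1) (hC : IsCompl C H)
    {K : Submodule F V} (hK : Disjoint K H) : annInd K ∈ Submodule.span ℤ
      (Set.range fun L : Hyperplane F V => annInd (sliceSubspace H C L)) := by
  classical
  have : Finite V := Module.finite_of_finite F
  have : Finite (Module.Dual F V) := Module.finite_of_finite F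
  have := Fintype.ofFinite (Hyperplane F V)
  have := Fintype.ofFinite (Module.Dual F V)
  set P := Submodule.span ℤ
    (Set.range fun L : Hyperplane F V => annInd (sliceSubspace H C L)) with hP
  set Q := P ⊔ Submodule.span ℤ {(annInd ⊤ : Module.Dual F V → ℤ)}
  have htop : annInd ⊤ ∈ Q := Submodule.mem_sup_right (Submodule.mem_span_singleton_self _)
  have hslice : ∀ L, annInd (sliceSubspace H C L) ∈ Q := fun L =>
    Submodule.mem_sup_left (Submodule.subset_span ⟨L, rfl⟩)
  have hcompl : ∀ L : Hyperplane F V, ¬ H ≤ (L : Submodule F V) →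
      annInd (L : Submodule F V) - annInd ⊤ ∈ Q := fun L hL =>
    sub_mem (sliceSubspace_of_not_le (C := C) hL ▸ hslice L) htop
  have hall : ∀ L : Hyperplane F V, annInd (L : Submodule F V) - annInd ⊤ ∈ Q := by
    intro M
    by_cases hM : H ≤ (M : Submodule F V)
    -- Any other hyperplane containing the slice of `M` cannot contain `H`, so its term is already
    -- in `Q` and the expansion can be solved for the term of `M`.
    · have h := annInd_eq_top_add_sum (sliceSubspace H C M)
      rw [← Finset.add_sum_erase _ _ (Finset.mem_univ M), if_pos (sliceSubspace_le M),
        add_left_comm] at h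
      rw [← sub_eq_iff_eq_add.2 h]
      refine sub_mem (hslice M) (add_mem htop (sum_mem fun L hL => ?_))
      split_ifs with hle
      · refine hcompl L fun hHL => Finset.ne_of_mem_erase hL (Hyperplane.eq_of_le ?_).symm
        exact (sliceSubspace_sup hC hM).ge.trans (sup_le hle hHL)
      · exact zero_mem _
    · exact hcompl M hM
  have hKQ : annInd K ∈ Q := by
    rw [annInd_eq_top_add_sum K]
    refine add_mem htop (sum_mem fun L _ => ?_)
    split_ifs
    · exact hall L
    · exact zero_mem _
  obtain ⟨x, hx, y, hy, hxy⟩ := Submodule.mem_sup.1 hKQ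
  obtain ⟨c, rfl⟩ := Submodule.mem_span_singleton.1 hy
  have hx0 : freeTrace H x = 0 := by
    have : P ≤ LinearMap.ker (freeTrace H) := by
      rw [hP, Submodule.span_le]
      rintro _ ⟨L, rfl⟩
      exact freeTrace_annInd hH (disjoint_sliceSubspace hH hC L)
    exact this hx
  have h := congrArg (freeTrace H) hxy
  rw [map_add, hx0, zero_add, map_smul, freeTrace_annInd hH hK, smul_eq_mul] at h
  have hc := (mul_eq_zero.1 h).resolve_right (freeTrace_annInd_top H)
  rw [hc, zero_smul, add_zero] at hxy
  exact hxy ▸ hx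

end Annihilator

/-! ### Counting subspaces -/

/-- Subspaces of a given dimension are counted in any space of the right dimension. -/
theorem numSubspaces_eq_card {p : ℕ} [Fact p.Prime] (k : ℕ) {m : ℕ} {V : Type} [AddCommGroup V]
    [Module (ZMod p) V] [FiniteDimensional (ZMod p) V] (hV : Module.finrank (ZMod p) V = m) :
    numSubspaces p k m =
      Nat.card {W : Submodule (ZMod p) V // Module.finrank (ZMod p) W = k} := by
  have e : (Fin m → ZMod p) ≃ₗ[ZMod p] V := LinearEquiv.ofFinrankEq _ _ (by simp [hV])
  refine Nat.card_congr ((Submodule.orderIsoMapComap e).toEquiv.subtypeEquiv fun W => ?_)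
  change _ ↔ Module.finrank (ZMod p) (W.map (e : (Fin m → ZMod p) →ₗ[ZMod p] V)) = k
  rw [LinearEquiv.finrank_map_eq]

/-- Lines and hyperplanes are equally many. -/
theorem numSubspaces_one_eq_card_hyperplane {p : ℕ} [Fact p.Prime] {m : ℕ} {V : Type}
    [AddCommGroup V] [Module (ZMod p) V] [FiniteDimensional (ZMod p) V]
    (hV : Module.finrank (ZMod p) V = m) :
    numSubspaces p 1 m = Nat.card (Hyperplane (ZMod p) V) := by
  rw [numSubspaces_eq_card 1 (V := Module.Dual (ZMod p) V) (by rw [Subspace.dual_finrank_eq, hV])]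
  refine (Nat.card_congr (((Subspace.orderIsoFiniteDimensional (K := ZMod p) (V := V)).toEquiv.trans
    OrderDual.ofDual).subtypeEquiv fun W => ?_)).symm
  have h := Subspace.finrank_add_finrank_dualAnnihilator_eq W
  change Module.finrank (ZMod p) W + 1 = _ ↔ Module.finrank (ZMod p) W.dualAnnihilator = 1
  omega

/-- Subspaces of small dimension, counted by dimension. -/
theorem card_finrank_lt {p : ℕ} [Fact p.Prime] {m : ℕ} {V : Type}
    [AddCommGroup V] [Module (ZMod p) V] [FiniteDimensional (ZMod p) V]
    (hV : Module.finrank (ZMod p) V = m) (n : ℕ) :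
    Nat.card {W : Submodule (ZMod p) V // Module.finrank (ZMod p) W < n} =
      ∑ k ∈ Finset.range n, numSubspaces p k m := by
  classical
  have : Finite V := Module.finite_of_finite (ZMod p)
  have := Fintype.ofFinite (Submodule (ZMod p) V)
  simp only [numSubspaces_eq_card _ hV, Nat.card_eq_fintype_card, Fintype.card_subtype]
  rw [Finset.card_eq_sum_card_fiberwise (f := fun W : Submodule (ZMod p) V =>
    Module.finrank (ZMod p) W) (t := Finset.range n) fun W hW => by simpa using hW]
  refine Finset.sum_congr rfl fun k hk => congrArg Finset.card ?_
  ext W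
  have := Finset.mem_range.1 hk
  simp only [Finset.mem_filter, Finset.mem_univ, true_and, and_iff_right_iff_imp]
  omega

/-- The line `0 × F`. -/
abbrev sndLine (F U : Type) [Field F] [AddCommGroup U] [Module F U] : Submodule F (U × F) :=
  LinearMap.range (LinearMap.inr F U F)

theorem finrank_sndLine (F U : Type) [Field F] [AddCommGroup U] [Module F U] :
    Module.finrank F (sndLine F U) = 1 := by
  rw [LinearMap.finrank_range_of_inj LinearMap.inr_injective, Module.finrank_self]

/-- This form serves twice: it says that `K` is the graph of a partial functional, and that
translation by the last factor is free on the cosets of `K`. -/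
theorem disjoint_sndLine_iff {F U : Type} [Field F] [AddCommGroup U] [Module F U]
    {K : Submodule F (U × F)} :
    Disjoint K (sndLine F U) ↔ ∀ x ∈ K, x.1 = 0 → x.2 = 0 := by
  rw [Submodule.disjoint_def]
  constructor
  · intro h x hx hx1
    exact congrArg Prod.snd (h x hx ⟨x.2, Prod.ext hx1.symm rfl⟩)
  · rintro h _ hx ⟨y, rfl⟩
    have : y = 0 := h _ hx rfl
    rw [this, map_zero]

/-- Subspaces disjoint from `0 × F` are graphs of partial linear functionals. -/
def disjointEquivPMap (F U : Type) [Field F] [AddCommGroup U] [Module F U] :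
    {K : Submodule F (U × F) // Disjoint K (sndLine F U)} ≃ Σ A : Submodule F U, A →ₗ[F] F where
  toFun K := ⟨K.1.toLinearPMap.domain, K.1.toLinearPMap.toFun⟩
  invFun f := ⟨(LinearPMap.mk f.1 f.2).graph, disjoint_sndLine_iff.2 fun x hx h =>
    LinearPMap.graph_fst_eq_zero_snd _ hx h⟩
  left_inv K := Subtype.ext (Submodule.toLinearPMap_graph_eq K.1 (disjoint_sndLine_iff.1 K.2))
  right_inv f := by
    have h := LinearPMap.eq_of_eq_graph (Submodule.toLinearPMap_graph_eq
      (LinearPMap.mk f.1 f.2).graph fun x hx h => LinearPMap.graph_fst_eq_zero_snd _ hx h)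
    exact congrArg (fun g : U →ₗ.[F] F => (⟨g.domain, g.toFun⟩ : Σ A : Submodule F U, A →ₗ[F] F)) h

/-- The subspaces disjoint from the last coordinate line. -/
theorem card_disjoint_sndLine (p : ℕ) [Fact p.Prime] (n : ℕ) :
    Nat.card {K : Submodule (ZMod p) ((Fin n → ZMod p) × ZMod p) //
      Disjoint K (sndLine (ZMod p) (Fin n → ZMod p))} =
      ∑ k ∈ Finset.range (n + 1), p ^ k * numSubspaces p k n := by
  classical
  have := Fintype.ofFinite (Submodule (ZMod p) (Fin n → ZMod p))
  have hA : ∀ A : Submodule (ZMod p) (Fin n → ZMod p),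
      Nat.card (A →ₗ[ZMod p] ZMod p) = p ^ Module.finrank (ZMod p) A := by
    intro A
    rw [Module.natCard_eq_pow_finrank (K := ZMod p), Nat.card_zmod]
    congr 1
    exact Subspace.dual_finrank_eq
  have : ∀ A : Submodule (ZMod p) (Fin n → ZMod p), Finite (A →ₗ[ZMod p] ZMod p) := fun A =>
    Module.finite_of_finite (ZMod p)
  rw [Nat.card_congr (disjointEquivPMap (ZMod p) (Fin n → ZMod p)), Nat.card_sigma]
  simp only [hA]
  -- Domains are grouped by dimension k; each carries p^k functionals.
  rw [← Finset.sum_fiberwise_of_maps_to (g := fun A : Submodule (ZMod p) (Fin n → ZMod p) =>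
    Module.finrank (ZMod p) A) (t := Finset.range (n + 1)) fun A _ => by
      have := Submodule.finrank_le A
      rw [Module.finrank_fin_fun] at this
      exact Finset.mem_range.2 (Nat.lt_succ_of_le this)]
  refine Finset.sum_congr rfl fun k _ => ?_
  rw [Finset.sum_congr rfl fun A hA => by rw [(Finset.mem_filter.1 hA).2], Finset.sum_const,
    numSubspaces, Nat.card_eq_fintype_card, Fintype.card_subtype, smul_eq_mul, mul_comm]

/-! ### Subgroups of elementary abelian groups -/

section ElemAb

variable {p n : ℕ} [Fact p.Prime]

/-- The vector space underlying `ℤ_p ^ n × ℤ_p`. -/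
abbrev ElemSpace (p n : ℕ) : Type := (Fin n → ZMod p) × ZMod p

theorem finrank_elemSpace : Module.finrank (ZMod p) (ElemSpace p n) = n + 1 := by
  rw [Module.finrank_prod, Module.finrank_fin_fun, Module.finrank_self]

/-- Subspaces are the same as subgroups. -/
def subgroupOfSubspace :
    Submodule (ZMod p) (ElemSpace p n) ≃o Subgroup (ElemAb p n × Multiplicative (ZMod p)) where
  toFun W :=
    { carrier := {g | (g.1.toAdd, g.2.toAdd) ∈ W}
      mul_mem' := fun ha hb => W.add_mem ha hb
      one_mem' := W.zero_mem
      inv_mem' := fun ha => W.neg_mem ha }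
  -- Closure under scalars is automatic: elements of `ZMod p` act as integer multiples.
  invFun K := AddSubgroup.toZModSubmodule p
    { carrier := {v | (Multiplicative.ofAdd v.1, Multiplicative.ofAdd v.2) ∈ K}
      add_mem' := fun ha hb => K.mul_mem ha hb
      zero_mem' := K.one_mem
      neg_mem' := fun ha => K.inv_mem ha }
  left_inv _ := rfl
  right_inv _ := rfl
  map_rel_iff' := Iff.rfl

theorem card_quotient_subgroupOfSubspace (W : Submodule (ZMod p) (ElemSpace p n)) :
    Nat.card ((ElemAb p n × Multiplicative (ZMod p)) ⧸ subgroupOfSubspace W) =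
      Nat.card (ElemSpace p n ⧸ W) := by
  have h1 := Subgroup.card_eq_card_quotient_mul_card_subgroup (subgroupOfSubspace W)
  have h2 := Submodule.card_eq_card_quotient_mul_card W
  have h3 : Nat.card (ElemAb p n × Multiplicative (ZMod p)) = Nat.card (ElemSpace p n) := rfl
  have h4 : Nat.card (subgroupOfSubspace W) = Nat.card W := rfl
  rw [h3, h4, h2, mul_comm] at h1
  exact (Nat.eq_of_mul_eq_mul_right Nat.card_pos h1).symm

/-- The Hom form on coset spaces is the Gram matrix of annihilator indicators. -/
theorem homDim_subgroupOfSubspace [Fintype (Module.Dual (ZMod p) (ElemSpace p n))]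
    (W W' : Submodule (ZMod p) (ElemSpace p n)) :
    (homDim (permMod (cosetSet (subgroupOfSubspace W)))
      (permMod (cosetSet (subgroupOfSubspace W'))) : ℤ) = ∑ φ, annInd W φ * annInd W' φ := by
  simp only [annInd_mul]
  rw [homDim_coset, ← OrderIso.map_sup, card_quotient_subgroupOfSubspace, sum_annInd]

/-! ### Assembling the two ranks -/

theorem grothendieckMap_linearCombination_relCoset {G H : Type} [CommGroup G] [CommGroup H]
    [Finite G] [Finite H] {ι : Type*} (K : ι → Subgroup (G × H))
    (hf : ∀ i, (cosetSet (K i)).IsFreeOver H) (x : ι →₀ ℤ) :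
    grothendieckMap (relFinGSetClass G H).subtype (Finsupp.linearCombination ℤ (fun i =>
      (GrothendieckAddGroup.of ⟨(cosetSet (K i)).cls, _, hf i, rfl⟩ : RelBurnside G H)) x) =
    Finsupp.linearCombination ℤ
      (fun i => (GrothendieckAddGroup.of (cosetSet (K i)).cls : BurnsideGroup (G × H))) x := by
  rw [of_coset_eq_grothendieckMap_comp K hf]
  exact Finsupp.apply_linearCombination ℤ
    (grothendieckMap (relFinGSetClass G H).subtype).toIntLinearMap _ x

theorem burnsideKernel_rank (p : ℕ) [Fact p.Prime] (n : ℕ) :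
    Module.Free ℤ (burnsideKernel (ElemAb p n × Multiplicative (ZMod p))) ∧
      Module.Finite ℤ (burnsideKernel (ElemAb p n × Multiplicative (ZMod p))) ∧
      Module.finrank ℤ (burnsideKernel (ElemAb p n × Multiplicative (ZMod p))) =
        ∑ k ∈ Finset.range n, numSubspaces p k (n + 1) := by
  classical
  have := Fintype.ofFinite (Submodule (ZMod p) (ElemSpace p n))
  have : Finite (Module.Dual (ZMod p) (ElemSpace p n)) := Module.finite_of_finite (ZMod p)
  have := Fintype.ofFinite (Module.Dual (ZMod p) (ElemSpace p n))
  obtain ⟨h1, h2, h3⟩ := kernel_rank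
    (burnsideMap (ElemAb p n × Multiplicative (ZMod p)))
    (fun W : Submodule (ZMod p) (ElemSpace p n) =>
      GrothendieckAddGroup.of (cosetSet (subgroupOfSubspace W)).cls)
    (linearIndependent_coset _ subgroupOfSubspace.injective)
    (top_le_span_coset _ subgroupOfSubspace.surjective) annInd
    (burnsideMap_eq_zero_iff _ _ homDim_subgroupOfSubspace)
    (fun W : {W : Submodule (ZMod p) (ElemSpace p n) //
      Module.finrank (ZMod p) (ElemSpace p n) ≤ Module.finrank (ZMod p) W + 1} => W.1)
    linearIndependent_annInd annInd_mem_span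
  refine ⟨h1, h2, ?_⟩
  rw [← card_finrank_lt finrank_elemSpace, Nat.card_eq_fintype_card]
  -- In dimension n + 1, failing to have codimension at most one means having dimension < n.
  have h4 := Fintype.card_subtype_compl fun W : Submodule (ZMod p) (ElemSpace p n) =>
    Module.finrank (ZMod p) (ElemSpace p n) ≤ Module.finrank (ZMod p) W + 1
  rw [← h3, Nat.add_sub_cancel] at h4
  rw [← h4]
  refine Fintype.card_congr (Equiv.subtypeEquivRight fun W => ?_)
  rw [finrank_elemSpace]
  omega

theorem cosetSet_subgroupOfSubspace_isFreeOver {K : Submodule (ZMod p) (ElemSpace p n)}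
    (hK : Disjoint K (sndLine (ZMod p) (Fin n → ZMod p))) :
    (cosetSet (subgroupOfSubspace K)).IsFreeOver (Multiplicative (ZMod p)) :=
  cosetSet_isFreeOver _ fun _ hh => disjoint_sndLine_iff.1 hK _ hh rfl

theorem relBurnsideKernel_rank (p : ℕ) [Fact p.Prime] (n : ℕ) :
    Module.Free ℤ (relBurnsideKernel (ElemAb p n) (Multiplicative (ZMod p))) ∧
      Module.Finite ℤ (relBurnsideKernel (ElemAb p n) (Multiplicative (ZMod p))) ∧
      (Module.finrank ℤ (relBurnsideKernel (ElemAb p n) (Multiplicative (ZMod p))) : ℤ) =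
        ∑ k ∈ Finset.range (n + 1), (p : ℤ) ^ k * (numSubspaces p k n : ℤ) -
          (numSubspaces p 1 (n + 1) : ℤ) := by
  classical
  let H := sndLine (ZMod p) (Fin n → ZMod p)
  obtain ⟨C, hC⟩ := exists_isCompl H
  have hH : Module.finrank (ZMod p) H = 1 := finrank_sndLine _ _
  have : Finite (Module.Dual (ZMod p) (ElemSpace p n)) := Module.finite_of_finite (ZMod p)
  have := Fintype.ofFinite (Module.Dual (ZMod p) (ElemSpace p n))
  let ι := {K : Submodule (ZMod p) (ElemSpace p n) // Disjoint K H}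
  have : Fintype ι := Fintype.ofFinite _
  have : Fintype (Hyperplane (ZMod p) (ElemSpace p n)) := Fintype.ofFinite _
  have hf : ∀ K : ι, (cosetSet (subgroupOfSubspace K.1)).IsFreeOver (Multiplicative (ZMod p)) :=
    fun K => cosetSet_subgroupOfSubspace_isFreeOver K.2
  obtain ⟨h1, h2, h3⟩ := kernel_rank
    (relBurnsideMap (ElemAb p n) (Multiplicative (ZMod p)))
    (fun K : ι => GrothendieckAddGroup.of ⟨(cosetSet (subgroupOfSubspace K.1)).cls, _, hf K, rfl⟩)
    (linearIndependent_relCoset (fun K : ι => subgroupOfSubspace K.1) hf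
      (subgroupOfSubspace.injective.comp Subtype.val_injective))
    (top_le_span_relCoset (fun K : ι => subgroupOfSubspace K.1) hf fun L hL => by
      obtain ⟨K, rfl⟩ := subgroupOfSubspace.surjective L
      refine ⟨⟨K, disjoint_sndLine_iff.2 ?_⟩, rfl⟩
      rintro ⟨x, y⟩ hx rfl
      exact hL (Multiplicative.ofAdd y) hx)
    (fun K => annInd K.1)
    (fun x => by
      -- Vanishing in the relative representation group is tested in the absolute one, where the
      -- Gram matrix criterion applies.
      rw [← (grothendieckMap_subtype_injective (relRatModClass (ElemAb p n)
        (Multiplicative (ZMod p)))).eq_iff, map_zero, grothendieckMap_subtype_relBurnsideMap,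
        ← burnsideMap_eq_zero_iff (fun K : ι => subgroupOfSubspace K.1) _
          (fun K K' => homDim_subgroupOfSubspace K.1 K'.1)]
      exact iff_of_eq (congrArg (fun a => burnsideMap _ a = 0)
        (grothendieckMap_linearCombination_relCoset _ hf x)))
    (fun L : Hyperplane (ZMod p) (ElemSpace p n) =>
      (⟨sliceSubspace H C L, disjoint_sliceSubspace hH hC.symm L⟩ : ι))
    (linearIndependent_annInd_slice hC.symm) (fun K => annInd_mem_span_slice hH hC.symm K.2)
  refine ⟨h1, h2, ?_⟩
  have h4 := card_disjoint_sndLine p n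
  rw [numSubspaces_one_eq_card_hyperplane finrank_elemSpace, Nat.card_eq_fintype_card,
    eq_sub_iff_add_eq]
  rw [Nat.card_eq_fintype_card (α := ι)] at h4
  exact_mod_cast h3.trans h4

end ElemAb

end

theorem mainTheorem2 (p : ℕ) [Fact p.Prime] (n : ℕ) :
    (Module.Free ℤ (burnsideKernel (ElemAb p n × Multiplicative (ZMod p))) ∧
      Module.Finite ℤ (burnsideKernel (ElemAb p n × Multiplicative (ZMod p))) ∧
      Module.finrank ℤ (burnsideKernel (ElemAb p n × Multiplicative (ZMod p))) =
        ∑ k ∈ Finset.range n, numSubspaces p k (n + 1)) ∧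
    (Module.Free ℤ (relBurnsideKernel (ElemAb p n) (Multiplicative (ZMod p))) ∧
      Module.Finite ℤ (relBurnsideKernel (ElemAb p n) (Multiplicative (ZMod p))) ∧
      (Module.finrank ℤ (relBurnsideKernel (ElemAb p n) (Multiplicative (ZMod p))) : ℤ) =
        ∑ k ∈ Finset.range (n + 1), (p : ℤ) ^ k * (numSubspaces p k n : ℤ) -
          (numSubspaces p 1 (n + 1) : ℤ)) :=
  ⟨burnsideKernel_rank p n, relBurnsideKernel_rank p n⟩
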